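/- Let $C$ be a coalgebra over a field $K$, with comultiplication $\Delta$, and let $C^*=\operatorname{Hom}_K(C,K)$ be its dual algebra under the convolution product $(fg)(c)=\sum f(c_1)g(c_2)$, with the finite topology, in which the subspaces $X^\perp=\{f\in C^* : f|_X=0\}$, for $X\subseteq C$ a finite-dimensional subspace, form a basis of neighbourhoods of $0$. A left $C^*$-module $M$ is rational if for every $m\in M$ there are finitely many $m_i\in M$, $c_i\in C$ with $f\cdot m=\sum_i f(c_i)m_i$ for all $f\in C^*$. Every right $C$-comodule is a left $C^*$-module by $f\cdot m=\sum f(m_1)m_0$. For subspaces $X,Y\subseteq C$ put $X\wedge Y=\Delta^{-1}(X\otimes C+C\otimes Y)$; $C$ is locally finite if $X\wedge Y$ is finite-dimensional whenever $X$ and $Y$ are. Let $C_0$ be the coradical of $C$, i.e. the sum of its simple subcoalgebras. The rational left $C^*$-modules are closed under extensions in the category of all left $C^*$-modules if and only if the following two conditions hold. (i) The set of closed two-sided ideals of finite codimension of $C^*$ is closed under products: if $I$ and $J$ are closed two-sided ideals of finite codimension, then $IJ$ is closed and of finite codimension. (ii) $\operatorname{Ext}^1_{C^*}(S,E)=0$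 for every simple right $C$-comodule $S$ and every injective right $C$-comodule $E$. Moreover, condition (i) is equivalent to: $C$ is locally finite and $V^\perp W^\perp=(V\wedge W)^\perp$ for all finite-dimensional subcoalgebras $V,W$ of $C$. Condition (ii) is equivalent to: $\operatorname{Ext}^1_{C^*}(S,C)=0$ for every simple right $C$-comodule $S$; and also to: $\operatorname{Ext}^1_{C^*}(C_0,C)=0$, where $C_0$ and $C$ are regarded as left $C^*$-modules. -/

import Mathlib

open TensorProduct Topology

universe u

namespace CoalgExt

section Basic

variable (K C : Type u) [Field K] [AddCommGroup C] [Module K C] [Coalgebra K C]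

/-- The dual algebra of the coalgebra `C`: linear functionals on `C` with the convolution product
`(f * g) c = ∑ f c₁ * g c₂` and with unit the counit. -/
abbrev DualAlg : Type u := WithConv (C →ₗ[K] K)

variable {C}

/-- The annihilator of a subspace `X` of `C` in the dual algebra. -/
def perp (X : Submodule K C) : Submodule K (DualAlg K C) where
  carrier := {f | ∀ x ∈ X, f x = 0}
  add_mem' {f g} hf hg x hx := by
    change f x + g x = 0
    rw [hf x hx, hg x hx, add_zero]
  zero_mem' _ _ := rfl
  smul_mem' a f hf x hx := by
    change a • f x = 0
    rw [hf x hx, smul_zero]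

variable (C) in
/-- The finite topology on the dual algebra: a set is open iff with each `f` it contains a coset
`f + perp X` for some finite-dimensional subspace `X` of `C`. -/
@[reducible] def finiteTopology : TopologicalSpace (DualAlg K C) where
  IsOpen U := ∀ f ∈ U, ∃ X : Submodule K C, FiniteDimensional K X ∧ ∀ g, g - f ∈ perp K X → g ∈ U
  isOpen_univ _ _ := ⟨⊥, inferInstance, fun _ _ => trivial⟩
  isOpen_inter U V hU hV f hf := by
    obtain ⟨X, hX, h1⟩ := hU f hf.1
    obtain ⟨Y, hY, h2⟩ := hV f hf.2
    exact ⟨X ⊔ Y, inferInstance, fun g hg =>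
      ⟨h1 g fun x hx => hg x (Submodule.mem_sup_left hx),
        h2 g fun x hx => hg x (Submodule.mem_sup_right hx)⟩⟩
  isOpen_sUnion s hs f hf := by
    obtain ⟨U, hU, hfU⟩ := hf
    obtain ⟨X, hX, h⟩ := hs U hU f hfU
    exact ⟨X, hX, fun g hg => ⟨U, hU, h g hg⟩⟩

/-- A (left) ideal of the dual algebra that is closed in the finite topology and has finite
codimension. -/
def IsClosedCofinite (I : Ideal (DualAlg K C)) : Prop :=
  IsClosed[finiteTopology K C] (I : Set (DualAlg K C)) ∧ FiniteDimensional K (DualAlg K C ⧸ I)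

variable (C) in
/-- The set of two-sided closed cofinite ideals of the dual algebra is stable under products. -/
def ClosedCofiniteIdealsStable : Prop :=
  ∀ I J : Ideal (DualAlg K C), I.IsTwoSided → J.IsTwoSided →
    IsClosedCofinite K I → IsClosedCofinite K J → IsClosedCofinite K (I * J)

/-- The wedge `X ∧ Y = Δ⁻¹(X ⊗ C + C ⊗ Y)`. -/
def wedge (X Y : Submodule K C) : Submodule K C :=
  (LinearMap.range (X.subtype.rTensor C) ⊔ LinearMap.range (Y.subtype.lTensor C)).comap
    (Coalgebra.comul (R := K) (A := C))

variable (C) in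
/-- `C` is locally finite: wedges of finite-dimensional subspaces are finite-dimensional. -/
def LocallyFinite : Prop :=
  ∀ X Y : Submodule K C, FiniteDimensional K X → FiniteDimensional K Y →
    FiniteDimensional K (wedge K X Y)

/-- `V` is a subcoalgebra: `Δ(V) ⊆ V ⊗ V`. -/
def IsSubcoalgebra (V : Submodule K C) : Prop :=
  ∀ v ∈ V, Coalgebra.comul (R := K) v ∈ LinearMap.range (TensorProduct.map V.subtype V.subtype)

/-- `V` is a simple subcoalgebra: nonzero, and without subcoalgebras other than `0` and `V`. -/
def IsSimpleSubcoalgebra (V : Submodule K C) : Prop :=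
  IsSubcoalgebra K V ∧ V ≠ ⊥ ∧ ∀ W ≤ V, IsSubcoalgebra K W → W = ⊥ ∨ W = V

variable (C) in
/-- The coradical `C₀`: the sum of all simple subcoalgebras. -/
def coradical : Submodule K C := sSup {V | IsSimpleSubcoalgebra K V}

end Basic

/-- A right `C`-comodule: a coassociative and counital coaction `ρ : M → M ⊗ C`. -/
class RightComodule (K C : Type u) (M : Type u) [Field K] [AddCommGroup C] [Module K C]
    [Coalgebra K C] [AddCommGroup M] [Module K M] where
  /-- The coaction. -/
  coact : M →ₗ[K] M ⊗[K] C
  coassoc : (TensorProduct.assoc K M C C).toLinearMap ∘ₗ coact.rTensor C ∘ₗ coact =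
    (Coalgebra.comul (R := K) (A := C)).lTensor M ∘ₗ coact
  counital : (TensorProduct.rid K M).toLinearMap ∘ₗ
    (Coalgebra.counit (R := K) (A := C)).lTensor M ∘ₗ coact = LinearMap.id

section Comodule

variable (K C : Type u) [Field K] [AddCommGroup C] [Module K C] [Coalgebra K C]

/-- `C` is a right comodule over itself. -/
instance : RightComodule K C C where
  coact := Coalgebra.comul
  coassoc := Coalgebra.coassoc
  counital := by
    ext c
    simp

variable (M : Type u) [AddCommGroup M] [Module K M] [RightComodule K C M]

variable {C} in
/-- The action `m ↦ ∑ f m₁ • m₀` of a functional `f` on a right comodule. -/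
def act (f : DualAlg K C) : M →ₗ[K] M :=
  (TensorProduct.rid K M).toLinearMap ∘ₗ f.ofConv.lTensor M ∘ₗ RightComodule.coact

lemma act_mul (f g : DualAlg K C) (m : M) : act K M (f * g) m = act K M f (act K M g m) := by
  have h1 : act K M (f * g) m = TensorProduct.rid K M
      ((LinearMap.mul' K K ∘ₗ TensorProduct.map f.ofConv g.ofConv).lTensor M
        ((Coalgebra.comul (R := K) (A := C)).lTensor M (RightComodule.coact m))) := by
    rw [← LinearMap.comp_apply (LinearMap.lTensor M _) (LinearMap.lTensor M _),
      ← LinearMap.lTensor_comp]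
    rfl
  have h2 := LinearMap.congr_fun (RightComodule.coassoc (K := K) (C := C) (M := M)) m
  simp only [LinearMap.comp_apply] at h2
  rw [h1, ← h2]
  change _ = act K M f (TensorProduct.rid K M (g.ofConv.lTensor M (RightComodule.coact m)))
  generalize (RightComodule.coact (K := K) (C := C) m : M ⊗[K] C) = t
  induction t with
  | zero => simp
  | add x y hx hy => simp only [map_add, hx, hy]
  | tmul n c =>
    simp only [LinearMap.rTensor_tmul, LinearMap.lTensor_tmul, TensorProduct.rid_tmul, map_smul]
    change _ = g.ofConv c •
      TensorProduct.rid K M (f.ofConv.lTensor M (RightComodule.coact n))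
    generalize (RightComodule.coact (K := K) (C := C) n : M ⊗[K] C) = s
    induction s with
    | zero => simp
    | add x y hx hy => simp only [map_add, TensorProduct.add_tmul, hx, hy, smul_add]
    | tmul p d => simp [smul_smul, mul_comm]

/-- The left module structure over the dual algebra on a right comodule. -/
instance ratModule : Module (DualAlg K C) M where
  smul f m := act K M f m
  one_smul m := LinearMap.congr_fun (RightComodule.counital (K := K) (C := C) (M := M)) m
  mul_smul f g m := act_mul K C M f g m
  smul_zero f := map_zero (act K M f)
  smul_add f := map_add (act K M f)
  add_smul f g m := by
    change act K M (f + g) m = act K M f m + act K M g m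
    simp [act, LinearMap.lTensor_add]
  zero_smul m := by
    change act K M (0 : DualAlg K C) m = 0
    simp [act]

variable {M} in
/-- `N` is a subcomodule of `M`: `ρ(N) ⊆ N ⊗ C`. -/
def IsSubcomodule (N : Submodule K M) : Prop :=
  ∀ n ∈ N, (RightComodule.coact n : M ⊗[K] C) ∈ LinearMap.range (N.subtype.rTensor C)

/-- A right comodule is simple: nonzero, and without subcomodules other than `0` and itself. -/
def IsSimpleComodule : Prop :=
  Nontrivial M ∧ ∀ N : Submodule K M, IsSubcomodule K C N → N = ⊥ ∨ N = ⊤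

variable {M} in
/-- A linear map between right comodules is a comodule map: it commutes with the coactions. -/
def IsComoduleHom {N : Type u} [AddCommGroup N] [Module K N] [RightComodule K C N]
    (f : M →ₗ[K] N) : Prop :=
  (RightComodule.coact : N →ₗ[K] N ⊗[K] C) ∘ₗ f = f.rTensor C ∘ₗ RightComodule.coact

/-- A right comodule is injective in the category of right comodules: comodule maps into it
extend along injective comodule maps. -/
def IsInjectiveComodule : Prop :=
  ∀ (X Y : Type u) [AddCommGroup X] [Module K X] [RightComodule K C X]
    [AddCommGroup Y] [Module K Y] [RightComodule K C Y] (i : X →ₗ[K] Y) (f : X →ₗ[K] M),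
    IsComoduleHom K C i → Function.Injective i → IsComoduleHom K C f →
      ∃ g : Y →ₗ[K] M, IsComoduleHom K C g ∧ g ∘ₗ i = f

/-- The coradical of `C` as a left submodule of `C` over the dual algebra. -/
def coradicalSubmodule : Submodule (DualAlg K C) C where
  carrier := coradical K C
  add_mem' := (coradical K C).add_mem
  zero_mem' := (coradical K C).zero_mem
  smul_mem' f c hc := by
    have key : coradical K C ≤ (coradical K C).comap (act K C f) := by
      refine sSup_le fun V hV v hv => ?_
      obtain ⟨t, ht⟩ := hV.1 v hv
      have hmem : act K C f v ∈ V := by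
        change TensorProduct.rid K C
          (f.ofConv.lTensor C (Coalgebra.comul (R := K) (A := C) v)) ∈ V
        rw [← ht]
        clear ht
        induction t with
        | zero => simp
        | add x y hx hy => simpa only [map_add] using V.add_mem hx hy
        | tmul x y => simpa using V.smul_mem _ x.2
      exact (le_sSup hV : V ≤ coradical K C) hmem
    exact key hc

/-- A left module over the dual algebra is rational: for each `m` there are finitely many `xᵢ` in
the module and `cᵢ` in `C` such that `f • m = ∑ f cᵢ • xᵢ` for all `f`. -/
def rational : CategoryTheory.ObjectProperty (ModuleCat.{u} (DualAlg K C)) := fun M =>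
  ∀ m : M, ∃ (n : ℕ) (x : Fin n → M) (c : Fin n → C), ∀ f : DualAlg K C,
    f • m = ∑ i, algebraMap K (DualAlg K C) (f (c i)) • x i

/-- `Ext¹` over the dual algebra of two left modules vanishes. -/
def ExtOneVanishes (X Y : Type u) [AddCommGroup X] [Module (DualAlg K C) X]
    [AddCommGroup Y] [Module (DualAlg K C) Y] : Prop :=
  Subsingleton (CategoryTheory.Abelian.Ext.{u} (ModuleCat.of (DualAlg K C) X)
    (ModuleCat.of (DualAlg K C) Y) 1)

/-- `Ext¹(S, E) = 0` for all simple right comodules `S` and injective right comodules `E`. -/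
def ExtSimpleInjectiveVanishes : Prop :=
  ∀ (S E : Type u) [AddCommGroup S] [Module K S] [RightComodule K C S]
    [AddCommGroup E] [Module K E] [RightComodule K C E],
    IsSimpleComodule K C S → IsInjectiveComodule K C E → ExtOneVanishes K C S E

end Comodule

end CoalgExt

namespace CoalgExt

section Dual

variable {K C : Type u} [Field K] [AddCommGroup C] [Module K C]

variable (K) in
lemma eq_of_eval {c d : C} (h : ∀ f : DualAlg K C, f c = f d) : c = d := by
  rw [← sub_eq_zero, ← Module.forall_dual_apply_eq_zero_iff K]
  intro f
  rw [map_sub, sub_eq_zero]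
  exact h (WithConv.toConv f)

@[simp] lemma add_eval (f g : DualAlg K C) (c : C) : (f + g) c = f c + g c := rfl
@[simp] lemma sub_eval (f g : DualAlg K C) (c : C) : (f - g) c = f c - g c := rfl
@[simp] lemma smul_eval (a : K) (f : DualAlg K C) (c : C) : (a • f) c = a * f c := rfl

lemma perp_anti {X Y : Submodule K C} (h : X ≤ Y) : perp K Y ≤ perp K X :=
  fun _ hf x hx => hf x (h hx)

lemma exists_eval_ne_zero_of_notMem {X : Submodule K C} {c : C} (hc : c ∉ X) :
    ∃ f ∈ perp K X, f c ≠ 0 := by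
  obtain ⟨f, hf, hX⟩ := Submodule.exists_le_ker_of_notMem hc
  exact ⟨WithConv.toConv f, fun x hx => hX hx, hf⟩

lemma mem_of_forall_perp {X : Submodule K C} {c : C} (h : ∀ f ∈ perp K X, f c = 0) : c ∈ X := by
  by_contra hc
  obtain ⟨f, hf, hfc⟩ := exists_eval_ne_zero_of_notMem hc
  exact hfc (h f hf)

variable (K) in
lemma tensor_eq_zero_of_lTensor {M : Type u} [AddCommGroup M] [Module K M] (t : M ⊗[K] C)
    (h : ∀ f : C →ₗ[K] K, TensorProduct.rid K M (f.lTensor M t) = 0) : t = 0 := by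
  classical
  let b := Module.Basis.ofVectorSpace K C
  apply (TensorProduct.equivFinsuppOfBasisRight (R := K) (M := M) b).injective
  ext i
  rw [map_zero, Finsupp.zero_apply, ← h (b.coord i)]
  clear h
  induction t with
  | zero => simp
  | add x y hx hy => simp only [map_add, Finsupp.add_apply, hx, hy]
  | tmul x y => simp

variable (K) in
lemma tensor_eq_of_map {B : Type u} [AddCommGroup B] [Module K B] {s t : B ⊗[K] C}
    (h : ∀ (f : B →ₗ[K] K) (g : C →ₗ[K] K),
      LinearMap.mul' K K (TensorProduct.map f g s) = LinearMap.mul' K K (TensorProduct.map f g t)) :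
    s = t := by
  rw [← sub_eq_zero]
  refine tensor_eq_zero_of_lTensor K _ fun g => ?_
  rw [← Module.forall_dual_apply_eq_zero_iff K]
  intro f
  have key : ∀ r : B ⊗[K] C, f (TensorProduct.rid K B (g.lTensor B r)) =
      LinearMap.mul' K K (TensorProduct.map f g r) := by
    intro r
    induction r with
    | zero => simp
    | add x y hx hy => simp only [map_add, hx, hy]
    | tmul x y => simp [mul_comm]
  rw [key, map_sub, map_sub, h, sub_self]

lemma tensor_eq_zero_of_lTensor_lTensor {M : Type u} [AddCommGroup M] [Module K M]
    (t : M ⊗[K] (C ⊗[K] C))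
    (h : ∀ f g : C →ₗ[K] K, TensorProduct.rid K M
      ((LinearMap.mul' K K ∘ₗ TensorProduct.map f g).lTensor M t) = 0) : t = 0 := by
  apply (TensorProduct.assoc K M C C).symm.injective
  rw [map_zero]
  refine tensor_eq_zero_of_lTensor K _ fun g => tensor_eq_zero_of_lTensor K _ fun f => ?_
  rw [← h f g]
  clear h
  induction t with
  | zero => simp
  | add x y hx hy => simp only [map_add, hx, hy]
  | tmul m s =>
    induction s with
    | zero => simp
    | add x y hx hy => simp only [TensorProduct.tmul_add, map_add, hx, hy]
    | tmul x y => simp [smul_smul, mul_comm]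

end Dual

section Pairing

variable {K C : Type u} [Field K] [AddCommGroup C] [Module K C] [Coalgebra K C]

lemma smul_def {M : Type u} [AddCommGroup M] [Module K M] [RightComodule K C M]
    (f : DualAlg K C) (m : M) : f • m = act K M f m := rfl

instance {M : Type u} [AddCommGroup M] [Module K M] [RightComodule K C M] :
    IsScalarTower K (DualAlg K C) M where
  smul_assoc a f m := by
    change act K M (a • f) m = a • act K M f m
    simp [act, LinearMap.lTensor_smul]

lemma mul_eval (f g : DualAlg K C) (c : C) : (f * g) c = f (g • c) := by
  change LinearMap.mul' K K (TensorProduct.map f.ofConv g.ofConv (Coalgebra.comul c)) =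
    f.ofConv (TensorProduct.rid K C (g.ofConv.lTensor C (Coalgebra.comul (R := K) c)))
  generalize (Coalgebra.comul (R := K) c) = t
  induction t with
  | zero => simp
  | add x y hx hy => simp only [map_add, hx, hy]
  | tmul x y => simp [mul_comm]

lemma algebraMap_smul_eq {M : Type u} [AddCommGroup M] [Module K M] [Module (DualAlg K C) M]
    [IsScalarTower K (DualAlg K C) M] (a : K) (m : M) : algebraMap K (DualAlg K C) a • m = a • m :=
  algebraMap_smul _ _ _

/-- Every element of the module is annihilated by an open subspace of the dual algebra. -/
def IsRat (K C : Type u) [Field K] [AddCommGroup C] [Module K C] [Coalgebra K C]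
    (M : Type u) [AddCommGroup M] [Module (DualAlg K C) M] : Prop :=
  ∀ m : M, ∃ X : Submodule K C, FiniteDimensional K X ∧ ∀ f ∈ perp K X, f • m = 0

lemma isRat_of_rightComodule {M : Type u} [AddCommGroup M] [Module K M] [RightComodule K C M] :
    IsRat K C M := by
  intro m
  have key : ∀ t : M ⊗[K] C, ∃ X : Submodule K C, FiniteDimensional K X ∧
      ∀ f ∈ perp K X, TensorProduct.rid K M (f.ofConv.lTensor M t) = 0 := by
    intro t
    induction t with
    | zero => exact ⟨⊥, inferInstance, fun f _ => by simp⟩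
    | add x y hx hy =>
      obtain ⟨X, _, hX⟩ := hx
      obtain ⟨Y, _, hY⟩ := hy
      exact ⟨X ⊔ Y, inferInstance, fun f hf => by
        rw [map_add, map_add, hX f (perp_anti le_sup_left hf), hY f (perp_anti le_sup_right hf),
          add_zero]⟩
    | tmul n c =>
      exact ⟨K ∙ c, inferInstance, fun f hf => by
        rw [LinearMap.lTensor_tmul, TensorProduct.rid_tmul]
        exact (congrArg (· • n) (hf c (Submodule.mem_span_singleton_self c))).trans
          (zero_smul _ _)⟩
  exact key _

variable {M N : Type u} [AddCommGroup M] [Module (DualAlg K C) M] [AddCommGroup N]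
  [Module (DualAlg K C) N]

lemma exists_sum_of_perp_smul_eq_zero (m : M) (X : Submodule K C) [FiniteDimensional K X]
    (hX : ∀ f ∈ perp K X, f • m = 0) :
    ∃ (n : ℕ) (x : Fin n → M) (c : Fin n → C), ∀ f : DualAlg K C,
      f • m = ∑ i, algebraMap K (DualAlg K C) (f (c i)) • x i := by
  let b := Module.finBasis K X
  have hg (i) : ∃ g : C →ₗ[K] K, ∀ x : X, g x = b.coord i x := by
    obtain ⟨g, hg⟩ := LinearMap.exists_extend (b.coord i)
    exact ⟨g, fun x => LinearMap.congr_fun hg x⟩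
  choose g hg using hg
  refine ⟨_, fun i => WithConv.toConv (g i) • m, fun i => b i, fun f => ?_⟩
  simp only [← mul_smul, ← Finset.sum_smul]
  rw [← sub_eq_zero, ← sub_smul]
  apply hX
  intro x hx
  simp only [← Algebra.smul_def, sub_eval, sub_eq_zero, WithConv.ofConv_sum, LinearMap.sum_apply,
    WithConv.ofConv_smul, LinearMap.smul_apply, hg _ ⟨x, hx⟩]
  have h : f.ofConv (X.subtype (∑ i, b.repr ⟨x, hx⟩ i • b i)) = f.ofConv x := by
    rw [b.sum_repr, Submodule.subtype_apply]
  rw [← h]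
  simp only [map_sum, map_smul, smul_eq_mul, Submodule.subtype_apply, Module.Basis.coord_apply,
    mul_comm]

lemma rational_iff : rational K C (ModuleCat.of (DualAlg K C) M) ↔ IsRat K C M := by
  constructor
  · intro h m
    obtain ⟨n, x, c, hc⟩ := h m
    refine ⟨Submodule.span K (Set.range c),
      FiniteDimensional.span_of_finite K (Set.finite_range c), fun f hf => ?_⟩
    refine (hc f).trans (Finset.sum_eq_zero fun i _ => ?_)
    rw [hf _ (Submodule.subset_span ⟨i, rfl⟩), map_zero]
    exact zero_smul (DualAlg K C) (x i)
  · intro h m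
    obtain ⟨X, _, hX⟩ := h m
    exact exists_sum_of_perp_smul_eq_zero (M := M) m X hX

lemma IsRat.of_injective (h : IsRat K C N) (f : M →ₗ[DualAlg K C] N) (hf : Function.Injective f) :
    IsRat K C M := by
  intro m
  obtain ⟨X, hX, h⟩ := h (f m)
  exact ⟨X, hX, fun a ha => hf (by rw [map_smul, h a ha, map_zero])⟩

lemma IsRat.of_surjective (h : IsRat K C M) (f : M →ₗ[DualAlg K C] N)
    (hf : Function.Surjective f) : IsRat K C N := by
  intro n
  obtain ⟨m, rfl⟩ := hf n
  obtain ⟨X, hX, h⟩ := h m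
  exact ⟨X, hX, fun a ha => by rw [← map_smul, h a ha, map_zero]⟩

/-- A rational module is a right comodule, with the given module structure. -/
lemma IsRat.exists_rightComodule [Module K M] [IsScalarTower K (DualAlg K C) M]
    (h : IsRat K C M) : ∃ I : RightComodule K C M, ratModule K C M = ‹Module (DualAlg K C) M› := by
  have ht (m : M) : ∃ t : M ⊗[K] C, ∀ f : DualAlg K C,
      TensorProduct.rid K M (f.ofConv.lTensor M t) = f • m := by
    obtain ⟨X, _, hX⟩ := h m
    obtain ⟨n, x, c, hc⟩ := exists_sum_of_perp_smul_eq_zero m X hX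
    exact ⟨∑ i, x i ⊗ₜ c i, fun f => by simp [hc]⟩
  choose ρ hρ using ht
  have huniq {s t : M ⊗[K] C} (h : ∀ f : DualAlg K C, TensorProduct.rid K M (f.ofConv.lTensor M s) =
      TensorProduct.rid K M (f.ofConv.lTensor M t)) : s = t := by
    rw [← sub_eq_zero]
    refine tensor_eq_zero_of_lTensor K _ fun f => ?_
    rw [map_sub, map_sub, sub_eq_zero]
    exact h (WithConv.toConv f)
  let R : M →ₗ[K] M ⊗[K] C :=
    { toFun := ρ
      map_add' := fun m n => huniq fun f => by simp only [hρ, map_add, smul_add]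
      map_smul' := fun a m => huniq fun f => by
        simp only [hρ, map_smul, RingHom.id_apply]
        rw [← algebraMap_smul_eq (C := C) a m, ← algebraMap_smul_eq (C := C) a, ← mul_smul,
          ← mul_smul, Algebra.commutes] }
  have hR (f : DualAlg K C) (m : M) : TensorProduct.rid K M (f.ofConv.lTensor M (R m)) = f • m :=
    hρ m f
  let I : RightComodule K C M :=
    { coact := R
      counital := by
        ext m
        exact (hR 1 m).trans (one_smul _ m)
      coassoc := by
        ext m
        rw [← sub_eq_zero]
        refine tensor_eq_zero_of_lTensor_lTensor _ fun f g => ?_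
        rw [map_sub, map_sub, sub_eq_zero]
        trans WithConv.toConv f • WithConv.toConv g • m
        · rw [← hR (WithConv.toConv g) m, LinearMap.comp_apply, LinearMap.comp_apply]
          generalize R m = t
          induction t with
          | zero => simp
          | add x y hx hy => simp only [map_add, hx, hy, smul_add]
          | tmul n c =>
            simp only [LinearMap.rTensor_tmul, LinearMap.lTensor_tmul, TensorProduct.rid_tmul,
              LinearEquiv.coe_coe]
            rw [← algebraMap_smul_eq (C := C) _ n, ← mul_smul, ← Algebra.commutes, mul_smul,
              algebraMap_smul_eq, ← hR]
            generalize R n = s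
            induction s with
            | zero => simp
            | add x y hx hy => simp only [map_add, hx, hy, TensorProduct.add_tmul, smul_add]
            | tmul p d => simp [smul_smul, mul_comm]
        · rw [← mul_smul, ← hR]
          exact congrArg (TensorProduct.rid K M) (LinearMap.congr_fun
            (LinearMap.lTensor_comp M (LinearMap.mul' K K ∘ₗ TensorProduct.map f g)
              (Coalgebra.comul (R := K) (A := C))) (R m)) }
  refine ⟨I, Module.ext' _ _ fun f m => ?_⟩
  exact hR f m

end Pairing

section Comodules

variable {K C : Type u} [Field K] [AddCommGroup C] [Module K C] [Coalgebra K C]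

lemma isComoduleHom_iff {M N : Type u} [AddCommGroup M] [Module K M] [RightComodule K C M]
    [AddCommGroup N] [Module K N] [RightComodule K C N] (f : M →ₗ[K] N) :
    IsComoduleHom K C f ↔ ∀ (a : DualAlg K C) (m : M), f (act K M a m) = act K N a (f m) := by
  have key (a : DualAlg K C) (m : M) : f (act K M a m) =
      TensorProduct.rid K N (a.ofConv.lTensor N (f.rTensor C (RightComodule.coact m))) := by
    change f (TensorProduct.rid K M (a.ofConv.lTensor M (RightComodule.coact m))) = _
    generalize (RightComodule.coact m : M ⊗[K] C) = t
    induction t with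
    | zero => simp
    | add x y hx hy => simp only [map_add, hx, hy]
    | tmul x y => simp
  constructor
  · intro h a m
    rw [key, ← LinearMap.comp_apply (f.rTensor C), ← h]
    rfl
  · intro h
    ext m
    rw [← sub_eq_zero]
    refine tensor_eq_zero_of_lTensor K _ fun a => ?_
    rw [map_sub, map_sub, sub_eq_zero]
    exact ((h (WithConv.toConv a) m).symm.trans (key _ m))

lemma isSubcomodule_iff {M : Type u} [AddCommGroup M] [Module K M] [RightComodule K C M]
    (N : Submodule K M) : IsSubcomodule K C N ↔ ∀ (a : DualAlg K C), ∀ n ∈ N, a • n ∈ N := by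
  constructor
  · intro h a n hn
    obtain ⟨t, ht⟩ := h n hn
    change TensorProduct.rid K M (a.ofConv.lTensor M (RightComodule.coact n)) ∈ N
    rw [← ht]
    clear ht
    induction t with
    | zero => simp
    | add x y hx hy => simpa only [map_add] using N.add_mem hx hy
    | tmul x y => simpa using N.smul_mem _ x.2
  · intro h n hn
    have hex := rTensor_exact C (LinearMap.exact_subtype_mkQ N) N.mkQ_surjective
    refine (hex _).1 (tensor_eq_zero_of_lTensor K _ fun a => ?_)
    have key (t : M ⊗[K] C) : TensorProduct.rid K (M ⧸ N) (a.lTensor _ (N.mkQ.rTensor C t)) =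
        N.mkQ (TensorProduct.rid K M (a.lTensor M t)) := by
      induction t with
      | zero => simp
      | add x y hx hy => simp only [map_add, hx, hy]
      | tmul x y => simp
    rw [key]
    exact (Submodule.Quotient.mk_eq_zero N).2 (h (WithConv.toConv a) n hn)

lemma isSimpleComodule_iff {M : Type u} [AddCommGroup M] [Module K M] [RightComodule K C M] :
    IsSimpleComodule K C M ↔ IsSimpleModule (DualAlg K C) M := by
  rw [isSimpleModule_iff]
  constructor
  · rintro ⟨h, h'⟩
    have : Nontrivial (Submodule (DualAlg K C) M) := inferInstance
    refine ⟨fun N => ?_⟩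
    refine (h' (N.restrictScalars K) ((isSubcomodule_iff _).2 fun a n hn => N.smul_mem a hn)).imp
      (fun h => ?_) fun h => ?_
    · exact (Submodule.restrictScalars_eq_bot_iff K _ _).1 h
    · exact (Submodule.restrictScalars_eq_top_iff K _ _).1 h
  · intro h
    refine ⟨(Submodule.nontrivial_iff (DualAlg K C)).1 h.toNontrivial, fun N hN => ?_⟩
    rw [isSubcomodule_iff] at hN
    let N' : Submodule (DualAlg K C) M := { N with smul_mem' := fun a n hn => hN a n hn }
    refine (h.eq_bot_or_eq_top N').imp (fun h => ?_) fun h => ?_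
    · ext x
      exact (SetLike.ext_iff.1 h x :)
    · ext x
      exact (SetLike.ext_iff.1 h x :)

/-- Homomorphisms into `E` extend along injections into rational modules. -/
def RatInj (K C : Type u) [Field K] [AddCommGroup C] [Module K C] [Coalgebra K C]
    (E : Type u) [AddCommGroup E] [Module (DualAlg K C) E] : Prop :=
  ∀ (X Y : Type u) [AddCommGroup X] [Module (DualAlg K C) X] [AddCommGroup Y]
    [Module (DualAlg K C) Y] (i : X →ₗ[DualAlg K C] Y) (f : X →ₗ[DualAlg K C] E),
    IsRat K C Y → Function.Injective i → ∃ g : Y →ₗ[DualAlg K C] E, g ∘ₗ i = f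

/-- An additive map that commutes with the action of the dual algebra. -/
def homOfSMul {M N : Type u} [AddCommGroup M] [Module (DualAlg K C) M] [AddCommGroup N]
    [Module (DualAlg K C) N] (f : M →+ N) (h : ∀ (a : DualAlg K C) m, f (a • m) = a • f m) :
    M →ₗ[DualAlg K C] N := { f with map_smul' := h }

/-- The restriction of scalars of a linear map over the dual algebra. -/
def restrictHom {M N : Type u} [AddCommGroup M] [Module (DualAlg K C) M] [AddCommGroup N]
    [Module (DualAlg K C) N] [Module K M] [IsScalarTower K (DualAlg K C) M] [Module K N]
    [IsScalarTower K (DualAlg K C) N] (f : M →ₗ[DualAlg K C] N) : M →ₗ[K] N :=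
  { f with
    map_smul' := fun a m => by
      change f (a • m) = a • f m
      rw [← algebraMap_smul_eq (C := C), map_smul, algebraMap_smul_eq] }

@[simp] lemma restrictHom_apply {M N : Type u} [AddCommGroup M] [Module (DualAlg K C) M]
    [AddCommGroup N] [Module (DualAlg K C) N] [Module K M] [IsScalarTower K (DualAlg K C) M]
    [Module K N] [IsScalarTower K (DualAlg K C) N] (f : M →ₗ[DualAlg K C] N) (m : M) :
    restrictHom f m = f m := rfl

lemma isScalarTower_compHom {M : Type u} [AddCommGroup M] [Module (DualAlg K C) M] :
    letI : Module K M := Module.compHom M (algebraMap K (DualAlg K C))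
    IsScalarTower K (DualAlg K C) M := by
  let _ : Module K M := Module.compHom M (algebraMap K (DualAlg K C))
  refine ⟨fun a f m => ?_⟩
  change _ = algebraMap K (DualAlg K C) a • f • m
  rw [Algebra.smul_def, mul_smul]

lemma IsRat.exists_act {M : Type u} [AddCommGroup M] [Module (DualAlg K C) M] [Module K M]
    [IsScalarTower K (DualAlg K C) M] (h : IsRat K C M) :
    ∃ _ : RightComodule K C M, ∀ (f : DualAlg K C) (m : M), act K M f m = f • m := by
  obtain ⟨I, hI⟩ := h.exists_rightComodule
  refine ⟨I, fun f m => ?_⟩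
  conv_rhs => rw [← hI]
  rfl

lemma isInjectiveComodule_iff {E : Type u} [AddCommGroup E] [Module K E] [RightComodule K C E] :
    IsInjectiveComodule K C E ↔ RatInj K C E := by
  constructor
  · intro h X Y _ _ _ _ i f hY hi
    let _ : Module K X := Module.compHom X (algebraMap K (DualAlg K C))
    let _ : Module K Y := Module.compHom Y (algebraMap K (DualAlg K C))
    have : IsScalarTower K (DualAlg K C) X := isScalarTower_compHom
    have : IsScalarTower K (DualAlg K C) Y := isScalarTower_compHom
    obtain ⟨IX, hX⟩ := (hY.of_injective i hi).exists_act
    obtain ⟨IY, hY⟩ := hY.exists_act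
    obtain ⟨g, hg, hgi⟩ := h X Y (restrictHom i) (restrictHom f)
      ((isComoduleHom_iff _).2 fun a m => by simp [hX, hY]) hi
      ((isComoduleHom_iff _).2 fun a m => by simp [hX, ← smul_def])
    refine ⟨homOfSMul g.toAddMonoidHom fun a m => ?_, ?_⟩
    · have := (isComoduleHom_iff _).1 hg a m
      rwa [hY] at this
    · ext x
      exact LinearMap.congr_fun hgi x
  · intro h X Y _ _ _ _ _ _ i f hi hinj hf
    rw [isComoduleHom_iff] at hi hf
    obtain ⟨g, hg⟩ := h X Y (homOfSMul i.toAddMonoidHom hi) (homOfSMul f.toAddMonoidHom hf)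
      isRat_of_rightComodule hinj
    refine ⟨restrictHom g, (isComoduleHom_iff _).2 fun a m => g.map_smul a m, ?_⟩
    ext x
    exact LinearMap.congr_fun hg x

/-- The homomorphism to a direct sum of copies of `C` that corresponds to a linear map. -/
lemma IsRat.exists_lift {Y : Type u} [AddCommGroup Y] [Module (DualAlg K C) Y] [Module K Y]
    [IsScalarTower K (DualAlg K C) Y] (hY : IsRat K C Y) {ι : Type u} (h : Y →ₗ[K] ι →₀ K) :
    ∃ g : Y →ₗ[DualAlg K C] ι →₀ C, ∀ y i (a : DualAlg K C), a (g y i) = h (a • y) i := by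
  have hex (y : Y) : ∃ c : ι →₀ C, ∀ i (a : DualAlg K C), a (c i) = h (a • y) i := by
    obtain ⟨X, _, hX⟩ := hY y
    obtain ⟨n, x, c, hc⟩ := exists_sum_of_perp_smul_eq_zero y X hX
    refine ⟨∑ j, Finsupp.mapRange.linearMap (LinearMap.toSpanSingleton K C (c j)) (h (x j)),
      fun i a => ?_⟩
    simp [hc, mul_comm]
  choose g hg using hex
  refine ⟨{ toFun := g, map_add' := fun x y => ?_, map_smul' := fun b y => ?_ }, hg⟩
  · ext i
    refine eq_of_eval K fun a => ?_
    simp [hg, map_add]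
  · ext i
    refine eq_of_eval K fun a => ?_
    simp only [RingHom.id_apply, Finsupp.smul_apply]
    rw [hg, ← mul_smul, ← mul_eval, hg]

lemma ratInj_finsupp (ι : Type u) : RatInj K C (ι →₀ C) := by
  intro X Y _ _ _ _ i f hY hi
  let _ : Module K X := Module.compHom X (algebraMap K (DualAlg K C))
  let _ : Module K Y := Module.compHom Y (algebraMap K (DualAlg K C))
  have : IsScalarTower K (DualAlg K C) X := isScalarTower_compHom
  have : IsScalarTower K (DualAlg K C) Y := isScalarTower_compHom
  obtain ⟨r, hr⟩ := (restrictHom i).exists_leftInverse_of_injective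
    (LinearMap.ker_eq_bot.2 (show Function.Injective (restrictHom i) from hi))
  obtain ⟨g, hg⟩ := hY.exists_lift
    (Finsupp.mapRange.linearMap (Coalgebra.counit (R := K) (A := C)) ∘ₗ restrictHom f ∘ₗ r)
  refine ⟨g, LinearMap.ext fun x => Finsupp.ext fun j => eq_of_eval K fun a => ?_⟩
  have h1 : r (i (a • x)) = a • x := LinearMap.congr_fun hr (a • x)
  rw [LinearMap.comp_apply, hg, ← map_smul, LinearMap.comp_apply, LinearMap.comp_apply, h1,
    restrictHom_apply, map_smul, Finsupp.mapRange.linearMap_apply, Finsupp.mapRange_apply,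
    Finsupp.smul_apply]
  trans (1 : DualAlg K C) (a • f x j)
  · rfl
  · rw [← mul_eval, one_mul]

lemma RatInj.of_retract {E F : Type u} [AddCommGroup E] [Module (DualAlg K C) E] [AddCommGroup F]
    [Module (DualAlg K C) F] (hF : RatInj K C F) (i : E →ₗ[DualAlg K C] F)
    (r : F →ₗ[DualAlg K C] E) (hr : r ∘ₗ i = LinearMap.id) : RatInj K C E := by
  intro X Y _ _ _ _ j f hY hj
  obtain ⟨g, hg⟩ := hF X Y j (i ∘ₗ f) hY hj
  exact ⟨r ∘ₗ g, by rw [LinearMap.comp_assoc, hg, ← LinearMap.comp_assoc, hr, LinearMap.id_comp]⟩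

lemma ratInj_self : RatInj K C C :=
  (ratInj_finsupp PUnit).of_retract (Finsupp.lsingle PUnit.unit) (Finsupp.lapply PUnit.unit)
    (by ext; simp)

lemma isRat_finsupp (ι : Type u) : IsRat K C (ι →₀ C) := by
  intro c
  induction c using Finsupp.induction_linear with
  | zero => exact ⟨⊥, inferInstance, fun f _ => smul_zero f⟩
  | add c d hc hd =>
    obtain ⟨X, _, hX⟩ := hc
    obtain ⟨Y, _, hY⟩ := hd
    exact ⟨X ⊔ Y, inferInstance, fun f hf => by
      rw [smul_add, hX f (perp_anti le_sup_left hf), hY f (perp_anti le_sup_right hf), add_zero]⟩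
  | single i c =>
    obtain ⟨X, hX, h⟩ := isRat_of_rightComodule (K := K) (C := C) c
    exact ⟨X, hX, fun f hf => by rw [Finsupp.smul_single, h f hf, Finsupp.single_zero]⟩

/-- A rational module embeds into a direct sum of copies of `C`. -/
lemma IsRat.exists_embedding {M : Type u} [AddCommGroup M] [Module (DualAlg K C) M]
    (hM : IsRat K C M) :
    ∃ (ι : Type u) (g : M →ₗ[DualAlg K C] ι →₀ C), Function.Injective g := by
  let _ : Module K M := Module.compHom M (algebraMap K (DualAlg K C))
  have : IsScalarTower K (DualAlg K C) M := isScalarTower_compHom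
  let b := Module.Basis.ofVectorSpace K M
  obtain ⟨g, hg⟩ := hM.exists_lift b.repr.toLinearMap
  refine ⟨_, g, (injective_iff_map_eq_zero g).2 fun m hm => b.repr.injective ?_⟩
  ext i
  have := hg m i 1
  rw [hm, one_smul] at this
  exact this.symm.trans (by simp)

end Comodules

section Subcoalgebras

variable {K C : Type u} [Field K] [AddCommGroup C] [Module K C] [Coalgebra K C]

lemma isSubcoalgebra_iff (V : Submodule K C) : IsSubcoalgebra K V ↔
    ∀ v ∈ V, ∀ f g : DualAlg K C, f ∈ perp K V ∨ g ∈ perp K V → (f * g) v = 0 := by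
  constructor
  · intro h v hv f g hfg
    obtain ⟨t, ht⟩ := h v hv
    change LinearMap.mul' K K (TensorProduct.map f.ofConv g.ofConv (Coalgebra.comul v)) = 0
    rw [← ht]
    clear ht
    induction t with
    | zero => simp
    | add x y hx hy => simp only [map_add, hx, hy, add_zero]
    | tmul x y =>
      rw [TensorProduct.map_tmul, TensorProduct.map_tmul, LinearMap.mul'_apply]
      rcases hfg with h | h
      · exact (congrArg (· * _) (h x x.2)).trans (zero_mul _)
      · exact (congrArg (_ * ·) (h y y.2)).trans (mul_zero _)
  · intro h v hv
    obtain ⟨r, hr⟩ := V.subtype.exists_leftInverse_of_injective V.ker_subtype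
    have hrV (x : C) (hx : x ∈ V) : r x = ⟨x, hx⟩ := LinearMap.congr_fun hr ⟨x, hx⟩
    refine ⟨TensorProduct.map r r (Coalgebra.comul v), tensor_eq_of_map K fun f g => ?_⟩
    let f' : DualAlg K C := WithConv.toConv (f ∘ₗ V.subtype ∘ₗ r)
    let g' : DualAlg K C := WithConv.toConv (g ∘ₗ V.subtype ∘ₗ r)
    have h1 := h v hv (f' - WithConv.toConv f) g' (Or.inl fun x hx => by simp [f', hrV x hx])
    have h2 := h v hv (WithConv.toConv f) (g' - WithConv.toConv g)
      (Or.inr fun x hx => by simp [g', hrV x hx])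
    rw [sub_mul, sub_eval, sub_eq_zero] at h1
    rw [mul_sub, sub_eval, sub_eq_zero] at h2
    refine Eq.trans ?_ (h1.trans h2)
    change _ = LinearMap.mul' K K (TensorProduct.map f'.ofConv g'.ofConv (Coalgebra.comul v))
    simp only [TensorProduct.map_map]
    rfl

lemma mem_wedge_iff {X Y : Submodule K C} {c : C} :
    c ∈ wedge K X Y ↔ ∀ f ∈ perp K X, ∀ g ∈ perp K Y, (f * g) c = 0 := by
  constructor
  · intro h f hf g hg
    change LinearMap.mul' K K (TensorProduct.map f.ofConv g.ofConv (Coalgebra.comul c)) = 0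
    refine (sup_le ?_ ?_ : _ ≤
      LinearMap.ker (LinearMap.mul' K K ∘ₗ TensorProduct.map f.ofConv g.ofConv)) h
    · rintro _ ⟨t, rfl⟩
      rw [LinearMap.mem_ker]
      induction t with
      | zero => simp
      | add x y hx hy => simp only [map_add, hx, hy, add_zero]
      | tmul x y => exact (congrArg (· * _) (hf x x.2)).trans (zero_mul _)
    · rintro _ ⟨t, rfl⟩
      rw [LinearMap.mem_ker]
      induction t with
      | zero => simp
      | add x y hx hy => simp only [map_add, hx, hy, add_zero]
      | tmul x y => exact (congrArg (_ * ·) (hg y y.2)).trans (mul_zero _)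
  · intro h
    have hker := TensorProduct.map_ker (LinearMap.exact_subtype_mkQ X) X.mkQ_surjective
      (LinearMap.exact_subtype_mkQ Y) Y.mkQ_surjective
    rw [wedge, Submodule.mem_comap, sup_comm, ← hker, LinearMap.mem_ker]
    refine tensor_eq_of_map K fun f g => ?_
    rw [TensorProduct.map_map, map_zero, map_zero]
    exact h (WithConv.toConv (f ∘ₗ X.mkQ)) (fun x hx => by simp [(Submodule.Quotient.mk_eq_zero X).2 hx])
      (WithConv.toConv (g ∘ₗ Y.mkQ)) fun x hx => by simp [(Submodule.Quotient.mk_eq_zero Y).2 hx]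

lemma wedge_mono {X Y V W : Submodule K C} (hX : X ≤ V) (hY : Y ≤ W) :
    wedge K X Y ≤ wedge K V W := fun _ hc => mem_wedge_iff.2 fun f hf g hg =>
  mem_wedge_iff.1 hc f (perp_anti hX hf) g (perp_anti hY hg)

variable (K C) in
/-- The left action of the dual algebra on the coalgebra as a bilinear map. -/
noncomputable def leftAct : DualAlg K C →ₗ[K] C →ₗ[K] C :=
  LinearMap.mk₂ K (fun f c => f • c) (fun f g c => add_smul f g c) (fun a f c => smul_assoc a f c)
    (fun f c d => smul_add f c d) fun a f c => (act K C f).map_smul a c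

variable (K C) in
/-- The right action of the dual algebra on the coalgebra as a bilinear map. -/
noncomputable def rightAct : DualAlg K C →ₗ[K] C →ₗ[K] C :=
  LinearMap.mk₂ K
    (fun f c => TensorProduct.lid K C (f.ofConv.rTensor C (Coalgebra.comul (R := K) c)))
    (fun f g c => by simp [LinearMap.rTensor_add]) (fun a f c => by simp [LinearMap.rTensor_smul])
    (fun f c d => by simp) fun a f c => by simp

lemma eval_rightAct (f g : DualAlg K C) (c : C) : f (rightAct K C g c) = (g * f) c := by
  change f.ofConv (TensorProduct.lid K C (g.ofConv.rTensor C (Coalgebra.comul (R := K) c))) =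
    LinearMap.mul' K K (TensorProduct.map g.ofConv f.ofConv (Coalgebra.comul c))
  generalize (Coalgebra.comul (R := K) c) = t
  induction t with
  | zero => simp
  | add x y hx hy => simp only [map_add, hx, hy]
  | tmul x y => simp

lemma finiteDimensional_range_leftAct_flip (c : C) :
    FiniteDimensional K (LinearMap.range ((leftAct K C).flip c)) := by
  obtain ⟨X, _, hX⟩ := isRat_of_rightComodule (K := K) (C := C) c
  obtain ⟨n, x, d, hd⟩ := exists_sum_of_perp_smul_eq_zero c X hX
  have := FiniteDimensional.span_of_finite K (Set.finite_range x)
  refine Submodule.finiteDimensional_of_le (S₂ := Submodule.span K (Set.range x)) ?_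
  rintro _ ⟨f, rfl⟩
  change f • c ∈ _
  rw [hd]
  simp only [algebraMap_smul_eq]
  exact Submodule.sum_mem _ fun i _ =>
    Submodule.smul_mem _ _ (Submodule.subset_span (Set.mem_range_self i))

lemma finiteDimensional_range_rightAct_flip (c : C) :
    FiniteDimensional K (LinearMap.range ((rightAct K C).flip c)) := by
  have key (t : C ⊗[K] C) : ∃ X : Submodule K C, FiniteDimensional K X ∧
      ∀ f : DualAlg K C, TensorProduct.lid K C (f.ofConv.rTensor C t) ∈ X := by
    induction t with
    | zero => exact ⟨⊥, inferInstance, fun f => by simp⟩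
    | add x y hx hy =>
      obtain ⟨X, _, hX⟩ := hx
      obtain ⟨Y, _, hY⟩ := hy
      refine ⟨X ⊔ Y, inferInstance, fun f => ?_⟩
      rw [map_add, map_add]
      exact Submodule.add_mem_sup (hX f) (hY f)
    | tmul x y =>
      exact ⟨K ∙ y, inferInstance, fun f =>
        Submodule.smul_mem _ _ (Submodule.mem_span_singleton_self y)⟩
  obtain ⟨X, _, hX⟩ := key (Coalgebra.comul (R := K) c)
  refine Submodule.finiteDimensional_of_le (S₂ := X) ?_
  rintro _ ⟨f, rfl⟩
  exact hX f

lemma finiteDimensional_map₂_top {A B D : Type u} [AddCommMonoid A] [Module K A] [AddCommGroup B]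
    [Module K B] [AddCommGroup D] [Module K D] (β : A →ₗ[K] B →ₗ[K] D)
    (h : ∀ b, FiniteDimensional K (LinearMap.range (β.flip b))) (X : Submodule K B)
    [FiniteDimensional K X] : FiniteDimensional K (Submodule.map₂ β ⊤ X) := by
  refine Submodule.fg_induction (motive := fun X _ => FiniteDimensional K (Submodule.map₂ β ⊤ X))
    (fun b => ?_) (fun X Y _ _ hX hY => ?_) X (Module.Finite.iff_fg.1 ‹_›)
  · rw [Submodule.map₂_span_singleton_eq_map_flip, ← LinearMap.range_eq_map]
    exact h b
  · rw [Submodule.map₂_sup_right]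
    infer_instance

/-- Every finite-dimensional subspace lies in a finite-dimensional subcoalgebra. -/
lemma exists_finiteDimensional_subcoalgebra (X : Submodule K C) [FiniteDimensional K X] :
    ∃ V : Submodule K C, X ≤ V ∧ FiniteDimensional K V ∧ IsSubcoalgebra K V := by
  let D := Submodule.map₂ (leftAct K C) ⊤ X
  have hD : FiniteDimensional K D :=
    finiteDimensional_map₂_top (leftAct K C) finiteDimensional_range_leftAct_flip X
  have hDstab (a : DualAlg K C) : D ≤ D.comap (leftAct K C a) := by
    refine Submodule.map₂_le.2 fun b _ x hx => ?_
    change a • b • x ∈ D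
    rw [← mul_smul]
    exact Submodule.apply_mem_map₂ (leftAct K C) trivial hx
  let V := Submodule.map₂ (rightAct K C) ⊤ D
  have hVl (a : DualAlg K C) : V ≤ V.comap (leftAct K C a) := by
    refine Submodule.map₂_le.2 fun b _ d hd => ?_
    have : leftAct K C a (rightAct K C b d) = rightAct K C b (leftAct K C a d) := by
      refine eq_of_eval K fun f => ?_
      change f (a • _) = _
      rw [← mul_eval, eval_rightAct, eval_rightAct, ← mul_assoc, mul_eval]
      rfl
    rw [Submodule.mem_comap, this]
    exact Submodule.apply_mem_map₂ (rightAct K C) trivial (hDstab a hd)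
  have hVr (a : DualAlg K C) : V ≤ V.comap (rightAct K C a) := by
    refine Submodule.map₂_le.2 fun b _ d hd => ?_
    have : rightAct K C a (rightAct K C b d) = rightAct K C (b * a) d :=
      eq_of_eval K fun f => by simp only [eval_rightAct, mul_assoc]
    rw [Submodule.mem_comap, this]
    exact Submodule.apply_mem_map₂ (rightAct K C) trivial hd
  refine ⟨V, fun x hx => ?_, finiteDimensional_map₂_top (rightAct K C) finiteDimensional_range_rightAct_flip D,
    (isSubcoalgebra_iff V).2 fun v hv f g hfg => ?_⟩
  · have h1 : rightAct K C 1 (leftAct K C 1 x) = x := eq_of_eval K fun f => by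
      rw [eval_rightAct, one_mul]
      exact congrArg f.ofConv (one_smul (DualAlg K C) x)
    rw [← h1]
    exact Submodule.apply_mem_map₂ (rightAct K C) trivial
      (Submodule.apply_mem_map₂ (leftAct K C) trivial hx)
  · rcases hfg with hf | hg
    · rw [mul_eval]
      exact hf _ (hVl g hv)
    · rw [← eval_rightAct]
      exact hg _ (hVr f hv)

/-- The annihilator of a subcoalgebra as an ideal. -/
lemma IsSubcoalgebra.exists_ideal {V : Submodule K C} (hV : IsSubcoalgebra K V) :
    ∃ I : Ideal (DualAlg K C), I.IsTwoSided ∧ I.restrictScalars K = perp K V := by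
  rw [isSubcoalgebra_iff] at hV
  exact ⟨{ perp K V with smul_mem' := fun f g hg v hv => hV v hv f g (Or.inr hg) },
    ⟨fun {f} g hf v hv => hV v hv f g (Or.inl hf)⟩, rfl⟩

lemma isSubcoalgebra_of_ideal {V : Submodule K C} {I : Ideal (DualAlg K C)} (hI : I.IsTwoSided)
    (h : I.restrictScalars K = perp K V) : IsSubcoalgebra K V := by
  have hmem (f : DualAlg K C) : f ∈ perp K V ↔ f ∈ I := by rw [← h]; rfl
  refine (isSubcoalgebra_iff V).2 fun v hv f g hfg => ?_
  simp only [hmem] at hfg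
  refine (hmem (f * g)).2 ?_ v hv
  exact hfg.elim (fun h => I.mul_mem_right g h) (I.mul_mem_left f)

lemma mul_restrictScalars {V W : Submodule K C} {I J : Ideal (DualAlg K C)}
    (hI : I.restrictScalars K = perp K V) (hJ : J.restrictScalars K = perp K W) :
    (I * J).restrictScalars K = perp K V * perp K W := by
  rw [← hI, ← hJ]
  refine le_antisymm (fun x hx => ?_) (Submodule.mul_le.2 fun f hf g hg => Ideal.mul_mem_mul hf hg)
  have hx : x ∈ I • J := hx
  refine Submodule.smul_induction_on (p := fun x => x ∈ I.restrictScalars K * J.restrictScalars K)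
    hx (fun f hf g hg => Submodule.mul_mem_mul hf hg) fun f g hf hg => Submodule.add_mem _ hf hg

/-- A module that is generated by an element with open annihilator is finite-dimensional. -/
lemma finite_of_perp_smul_eq_zero {M : Type u} [AddCommGroup M] [Module (DualAlg K C) M]
    [Module K M] [IsScalarTower K (DualAlg K C) M] (m : M)
    (hm : ∀ y, ∃ f : DualAlg K C, f • m = y) (X : Submodule K C) [FiniteDimensional K X]
    (hX : ∀ f ∈ perp K X, f • m = 0) : Module.Finite K M := by
  obtain ⟨n, x, d, hd⟩ := exists_sum_of_perp_smul_eq_zero m X hX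
  refine ⟨Submodule.fg_def.2 ⟨Set.range x, Set.finite_range x, top_le_iff.1 fun y _ => ?_⟩⟩
  obtain ⟨f, rfl⟩ := hm y
  rw [hd]
  simp only [algebraMap_smul_eq]
  exact Submodule.sum_mem _ fun i _ =>
    Submodule.smul_mem _ _ (Submodule.subset_span (Set.mem_range_self i))

lemma isClosedCofinite_of_perp_le {I : Ideal (DualAlg K C)} (X : Submodule K C)
    [FiniteDimensional K X] (h : perp K X ≤ I.restrictScalars K) : IsClosedCofinite K I := by
  constructor
  · rw [← @isOpen_compl_iff _ _ (finiteTopology K C)]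
    refine fun f hf => ⟨X, inferInstance, fun g hg hgI => hf ?_⟩
    simpa using I.sub_mem hgI (h hg)
  · refine finite_of_perp_smul_eq_zero (Submodule.Quotient.mk 1 : DualAlg K C ⧸ I) ?_ X ?_
    · intro y
      obtain ⟨f, rfl⟩ := Submodule.Quotient.mk_surjective _ y
      exact ⟨f, congrArg Submodule.Quotient.mk (mul_one f)⟩
    · intro f hf
      exact (congrArg Submodule.Quotient.mk (mul_one f)).trans
        ((Submodule.Quotient.mk_eq_zero I).2 (h hf))

/-- The restriction of functionals to a subspace. -/
def restrictDual (X : Submodule K C) : DualAlg K C →ₗ[K] Module.Dual K X where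
  toFun f := f.ofConv ∘ₗ X.subtype
  map_add' _ _ := rfl
  map_smul' _ _ := rfl

omit [Coalgebra K C] in
lemma restrictDual_surjective (X : Submodule K C) : Function.Surjective (restrictDual X) := by
  intro f
  obtain ⟨g, hg⟩ := LinearMap.exists_extend f
  exact ⟨WithConv.toConv g, hg⟩

lemma IsClosedCofinite.exists_eq_perp {I : Ideal (DualAlg K C)} (hI : IsClosedCofinite K I) :
    ∃ V : Submodule K C, FiniteDimensional K V ∧ I.restrictScalars K = perp K V := by
  obtain ⟨hcl, hfd⟩ := hI
  rw [← @isOpen_compl_iff _ _ (finiteTopology K C)] at hcl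
  let V : Submodule K C := 
    { carrier := {c | ∀ f ∈ I, f c = 0}
      add_mem' := fun {c d} hc hd f hf => by rw [map_add, hc f hf, hd f hf, add_zero]
      zero_mem' := fun f _ => map_zero _
      smul_mem' := fun a c hc f hf => by rw [map_smul, hc f hf, smul_zero] }
  have hIV : I.restrictScalars K = perp K V := by
    refine le_antisymm (fun f hf c hc => hc f hf) fun g hg => ?_
    by_contra hgI
    obtain ⟨X, _, hX⟩ := hcl g hgI
    let W := (I.restrictScalars K).map (restrictDual X)
    have hgW : restrictDual X g ∉ W := by
      rintro ⟨f, hf, hfg⟩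
      refine hX f (fun x hx => ?_) hf
      rw [sub_eval, sub_eq_zero]
      exact LinearMap.congr_fun hfg ⟨x, hx⟩
    have : FiniteDimensional K W := FiniteDimensional.finiteDimensional_submodule W
    refine hgW ?_
    rw [← Subspace.dualCoannihilator_dualAnnihilator_eq (W := W), Submodule.mem_dualAnnihilator]
    intro x hx
    rw [Submodule.mem_dualCoannihilator] at hx
    exact hg x fun f hf => hx _ ⟨f, hf, rfl⟩
  refine ⟨V, ?_, hIV⟩
  have : FiniteDimensional K (DualAlg K C ⧸ I.restrictScalars K) :=
    Module.Finite.equiv (Submodule.Quotient.restrictScalarsEquiv K I).symm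
  have hle : I.restrictScalars K ≤ LinearMap.ker (restrictDual V) := by
    rw [hIV]
    exact fun f hf => LinearMap.ext fun x => hf x x.2
  have : Module.Finite K (Module.Dual K V) := Module.Finite.of_surjective
    ((I.restrictScalars K).liftQ (restrictDual V) hle) fun f => by
      obtain ⟨g, rfl⟩ := restrictDual_surjective V f
      exact ⟨Submodule.Quotient.mk g, rfl⟩
  exact (Module.finite_dual_iff K).1 this

lemma eq_wedge_of_perp_eq_mul {U V W : Submodule K C} (h : perp K U = perp K V * perp K W) :
    U = wedge K V W := by
  ext c
  rw [mem_wedge_iff]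
  constructor
  · intro hc f hf g hg
    have : f * g ∈ perp K U := h ▸ Submodule.mul_mem_mul hf hg
    exact this c hc
  · intro hc
    refine mem_of_forall_perp fun f hf => ?_
    rw [h] at hf
    exact Submodule.mul_induction_on hf hc fun f g hf hg => by rw [add_eval, hf, hg, add_zero]

theorem closedCofiniteIdealsStable_iff : ClosedCofiniteIdealsStable K C ↔ LocallyFinite K C ∧
    ∀ V W : Submodule K C, IsSubcoalgebra K V → IsSubcoalgebra K W →
      FiniteDimensional K V → FiniteDimensional K W →
      perp K V * perp K W = perp K (wedge K V W) := by
  constructor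
  · intro h
    have key (V W : Submodule K C) (hV : IsSubcoalgebra K V) (hW : IsSubcoalgebra K W)
        (_ : FiniteDimensional K V) (_ : FiniteDimensional K W) :
        perp K V * perp K W = perp K (wedge K V W) ∧ FiniteDimensional K (wedge K V W) := by
      obtain ⟨I, hI, hIV⟩ := hV.exists_ideal
      obtain ⟨J, hJ, hJW⟩ := hW.exists_ideal
      obtain ⟨U, hU, hIJ⟩ := (h I J hI hJ (isClosedCofinite_of_perp_le V hIV.ge)
        (isClosedCofinite_of_perp_le W hJW.ge)).exists_eq_perp
      rw [mul_restrictScalars hIV hJW] at hIJ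
      rw [← eq_wedge_of_perp_eq_mul hIJ.symm]
      exact ⟨hIJ, hU⟩
    refine ⟨fun X Y _ _ => ?_, fun V W hV hW hV' hW' => (key V W hV hW hV' hW').1⟩
    obtain ⟨V, hXV, hVfd, hV⟩ := exists_finiteDimensional_subcoalgebra X
    obtain ⟨W, hYW, hWfd, hW⟩ := exists_finiteDimensional_subcoalgebra Y
    have := (key V W hV hW hVfd hWfd).2
    exact Submodule.finiteDimensional_of_le (wedge_mono hXV hYW)
  · rintro ⟨hlf, h⟩ I J hI hJ hIc hJc
    obtain ⟨V, hV, hIV⟩ := hIc.exists_eq_perp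
    obtain ⟨W, hW, hJW⟩ := hJc.exists_eq_perp
    have := hlf V W hV hW
    refine isClosedCofinite_of_perp_le (wedge K V W) ?_
    rw [mul_restrictScalars hIV hJW, h V W (isSubcoalgebra_of_ideal hI hIV)
      (isSubcoalgebra_of_ideal hJ hJW) hV hW]

end Subcoalgebras

section Ring

lemma exists_projective_presentation (R : Type u) [Ring R] (M : Type u) [AddCommGroup M]
    [Module R M] : ∃ (P : Type u) (_ : AddCommGroup P) (_ : Module R P) (p : P →ₗ[R] M),
      Module.Projective R P ∧ Function.Surjective p :=
  ⟨M →₀ R, inferInstance, inferInstance, Finsupp.linearCombination R id, inferInstance,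
    Finsupp.linearCombination_id_surjective R M⟩

lemma exists_isSimpleModule_of_finite (K : Type u) {R M : Type u} [Field K] [Ring R] [Algebra K R]
    [AddCommGroup M] [Module R M] [Module K M] [IsScalarTower K R M] (N : Submodule R M)
    [Nontrivial N] (h : Module.Finite K N) : ∃ S : Submodule R M, IsSimpleModule R S := by
  have : IsArtinian R N := isArtinian_of_tower K inferInstance
  obtain ⟨S, hS⟩ := IsAtomic.exists_atom (Submodule R N)
  have := isSimpleModule_iff_isAtom.2 hS
  exact ⟨S.map N.subtype,
    IsSimpleModule.congr (S.equivMapOfInjective N.subtype N.subtype_injective).symm⟩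

end Ring

section Ext

open CategoryTheory Abelian

variable {K C : Type u} [Field K] [AddCommGroup C] [Module K C] [Coalgebra K C]
  {P X Y : Type u} [AddCommGroup P] [Module (DualAlg K C) P] [AddCommGroup X]
  [Module (DualAlg K C) X] [AddCommGroup Y] [Module (DualAlg K C) Y]

lemma ExtOneVanishes.exists_extension (h : ExtOneVanishes K C X Y) (p : P →ₗ[DualAlg K C] X)
    (hp : Function.Surjective p) (φ : LinearMap.ker p →ₗ[DualAlg K C] Y) :
    ∃ ψ : P →ₗ[DualAlg K C] Y, ψ ∘ₗ (LinearMap.ker p).subtype = φ := by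
  have hS := LinearMap.shortExact_shortComplexKer hp
  obtain ⟨x, hx⟩ := Ext.contravariant_sequence_exact₁ hS
    (Y := ModuleCat.of (DualAlg K C) Y) (Ext.mk₀ (ModuleCat.ofHom φ)) (n₁ := 1) rfl
    (@Subsingleton.elim _ h _ _)
  obtain ⟨ψ, rfl⟩ := (Ext.mk₀_bijective _ _).2 x
  rw [Ext.mk₀_comp_mk₀] at hx
  have := (Ext.mk₀_bijective _ _).1 hx
  exact ⟨ψ.hom, congrArg ModuleCat.Hom.hom this⟩

lemma extOneVanishes_of_projective [Module.Projective (DualAlg K C) P]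
    (p : P →ₗ[DualAlg K C] X) (hp : Function.Surjective p)
    (h : ∀ φ : LinearMap.ker p →ₗ[DualAlg K C] Y,
      ∃ ψ : P →ₗ[DualAlg K C] Y, ψ ∘ₗ (LinearMap.ker p).subtype = φ) :
    ExtOneVanishes K C X Y := by
  have hS := LinearMap.shortExact_shortComplexKer hp
  have : Projective (ModuleCat.of (DualAlg K C) P) :=
    ModuleCat.projective_of_categoryTheory_projective _
  refine subsingleton_of_forall_eq 0 fun e => ?_
  obtain ⟨x, rfl⟩ := Ext.contravariant_sequence_exact₃ hS _ e
    (Ext.eq_zero_of_projective (P := ModuleCat.of (DualAlg K C) P) _) (n₀ := 0) rfl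
  obtain ⟨φ, rfl⟩ := (Ext.mk₀_bijective _ _).2 x
  obtain ⟨ψ, hψ⟩ := h φ.hom
  have hφ : φ = ModuleCat.ofHom (LinearMap.ker p).subtype ≫ ModuleCat.ofHom ψ :=
    ModuleCat.hom_ext hψ.symm
  rw [hφ, ← Ext.mk₀_comp_mk₀]
  exact hS.extClass_comp_assoc _

lemma ExtOneVanishes.of_retract {Z : Type u} [AddCommGroup Z] [Module (DualAlg K C) Z]
    (h : ExtOneVanishes K C X Y) (i : Z →ₗ[DualAlg K C] X) (r : X →ₗ[DualAlg K C] Z)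
    (hr : r ∘ₗ i = LinearMap.id) : ExtOneVanishes K C Z Y := by
  refine subsingleton_of_forall_eq 0 fun e => ?_
  have h1 : (Ext.mk₀ (ModuleCat.ofHom r)).comp e (zero_add 1) = 0 := @Subsingleton.elim _ h _ _
  have h2 : ModuleCat.ofHom i ≫ ModuleCat.ofHom r = 𝟙 (ModuleCat.of (DualAlg K C) Z) :=
    ModuleCat.hom_ext hr
  rw [← Ext.mk₀_id_comp e, ← h2, ← Ext.mk₀_comp_mk₀_assoc, h1, Ext.comp_zero]

end Ext

section Extensions

variable {K C : Type u} [Field K] [AddCommGroup C] [Module K C] [Coalgebra K C]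

variable (K C) in
/-- Extensions of rational modules by rational modules are rational. -/
def RatExt : Prop :=
  ∀ (M Q : Type u) [AddCommGroup M] [Module (DualAlg K C) M] [AddCommGroup Q]
    [Module (DualAlg K C) Q] (p : M →ₗ[DualAlg K C] Q), Function.Surjective p →
    IsRat K C (LinearMap.ker p) → IsRat K C Q → IsRat K C M

lemma isClosedUnderExtensions_iff : (rational K C).IsClosedUnderExtensions ↔ RatExt K C := by
  constructor
  · intro h M Q _ _ _ _ p hp hker hQ
    exact rational_iff.1 (h.prop_X₂_of_shortExact (LinearMap.shortExact_shortComplexKer hp)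
      (rational_iff.2 hker) (rational_iff.2 hQ))
  · refine fun h => ⟨fun {S} hS h1 h3 => ?_⟩
    refine (rational_iff (M := S.X₂)).2 (h _ S.X₃ S.g.hom hS.moduleCat_surjective_g ?_
      ((rational_iff (M := S.X₃)).1 h3))
    refine ((rational_iff (M := S.X₁)).1 h1).of_surjective (S.f.hom.codRestrict _ fun x =>
      S.moduleCat_zero_apply x) fun y => ?_
    obtain ⟨x, hx⟩ := (S.moduleCat_exact_iff.1 hS.exact) y.1 y.2
    exact ⟨x, Subtype.ext hx⟩

lemma RatExt.closedCofiniteIdealsStable (h : RatExt K C) : ClosedCofiniteIdealsStable K C := by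
  intro I J hI hJ hIc hJc
  obtain ⟨V, hV, hIV⟩ := hIc.exists_eq_perp
  obtain ⟨W, hW, hJW⟩ := hJc.exists_eq_perp
  have hle : I * J ≤ J := Ideal.mul_le_right
  have hrat : IsRat K C (DualAlg K C ⧸ I * J) := by
    refine h _ (DualAlg K C ⧸ J) (Submodule.factor hle) (Submodule.factor_surjective hle) ?_ ?_
    · rintro ⟨m, hm⟩
      obtain ⟨a, rfl⟩ := Submodule.Quotient.mk_surjective _ m
      have ha : a ∈ J := (Submodule.Quotient.mk_eq_zero J).1 hm
      refine ⟨V, hV, fun f hf => Subtype.ext ?_⟩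
      rw [← hIV] at hf
      exact (Submodule.Quotient.mk_eq_zero (I * J)).2 (Ideal.mul_mem_mul hf ha)
    · intro m
      obtain ⟨a, rfl⟩ := Submodule.Quotient.mk_surjective _ m
      refine ⟨W, hW, fun f hf => ?_⟩
      rw [← hJW] at hf
      exact (Submodule.Quotient.mk_eq_zero J).2 (J.mul_mem_right a hf)
  obtain ⟨X, _, hX⟩ := hrat (Submodule.Quotient.mk 1)
  refine isClosedCofinite_of_perp_le X fun f hf => ?_
  have := hX f hf
  rwa [← Submodule.Quotient.mk_smul, Submodule.Quotient.mk_eq_zero, smul_eq_mul, mul_one] at this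

lemma RatInj.extOneVanishes {X E : Type u} [AddCommGroup X] [Module (DualAlg K C) X]
    [AddCommGroup E] [Module (DualAlg K C) E] (h : RatExt K C) (hX : IsRat K C X)
    (hE : RatInj K C E) (hE' : IsRat K C E) : ExtOneVanishes K C X E := by
  obtain ⟨P, _, _, p, _, hp⟩ := exists_projective_presentation (DualAlg K C) X
  refine extOneVanishes_of_projective p hp fun φ => ?_
  let N := (LinearMap.ker φ).map (LinearMap.ker p).subtype
  have hN : N ≤ LinearMap.ker p := Submodule.map_subtype_le _ _
  let q : (P ⧸ N) →ₗ[DualAlg K C] X := N.liftQ p hN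
  let j : (LinearMap.ker p ⧸ LinearMap.ker φ) →ₗ[DualAlg K C] (P ⧸ N) :=
    (LinearMap.ker φ).mapQ N (LinearMap.ker p).subtype (Submodule.map_le_iff_le_comap.1 le_rfl)
  have hj : Function.Injective j := by
    rw [injective_iff_map_eq_zero]
    intro x hx
    obtain ⟨x, rfl⟩ := Submodule.Quotient.mk_surjective _ x
    obtain ⟨y, hy, hyx⟩ := (Submodule.Quotient.mk_eq_zero N).1 hx
    rw [Submodule.Quotient.mk_eq_zero]
    rwa [← Subtype.ext (a1 := y) (a2 := x) hyx]
  let φ' : (LinearMap.ker p ⧸ LinearMap.ker φ) →ₗ[DualAlg K C] E :=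
    (LinearMap.ker φ).liftQ φ le_rfl
  have hφ' : Function.Injective φ' := LinearMap.ker_eq_bot.1 (Submodule.ker_liftQ_eq_bot _ _ _ le_rfl)
  have hrat : IsRat K C (P ⧸ N) := by
    refine h _ X q (fun x => ?_) ?_ hX
    · obtain ⟨y, rfl⟩ := hp x
      exact ⟨Submodule.Quotient.mk y, rfl⟩
    · refine (hE'.of_injective φ' hφ').of_surjective (j.codRestrict _ fun x => ?_) fun y => ?_
      · obtain ⟨x, rfl⟩ := Submodule.Quotient.mk_surjective _ x
        exact x.2
      · obtain ⟨y, hy⟩ := y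
        obtain ⟨y, rfl⟩ := Submodule.Quotient.mk_surjective _ y
        exact ⟨Submodule.Quotient.mk ⟨y, hy⟩, rfl⟩
  obtain ⟨g, hg⟩ := hE _ _ j φ' hrat hj
  refine ⟨g ∘ₗ N.mkQ, LinearMap.ext fun x => ?_⟩
  exact LinearMap.congr_fun hg (Submodule.Quotient.mk x)

lemma RatExt.extSimpleInjectiveVanishes (h : RatExt K C) : ExtSimpleInjectiveVanishes K C :=
  fun _ _ _ _ _ _ _ _ _ hE => (isInjectiveComodule_iff.1 hE).extOneVanishes h
    isRat_of_rightComodule isRat_of_rightComodule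

/-- The largest rational submodule. -/
def ratPart (M : Type u) [AddCommGroup M] [Module (DualAlg K C) M] :
    Submodule (DualAlg K C) M where
  carrier := {m | ∃ X : Submodule K C, FiniteDimensional K X ∧ ∀ f ∈ perp K X, f • m = 0}
  add_mem' := by
    rintro m n ⟨X, _, hX⟩ ⟨Y, _, hY⟩
    exact ⟨X ⊔ Y, inferInstance, fun f hf => by
      rw [smul_add, hX f (perp_anti le_sup_left hf), hY f (perp_anti le_sup_right hf), add_zero]⟩
  zero_mem' := ⟨⊥, inferInstance, fun f _ => smul_zero f⟩
  smul_mem' := by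
    rintro a m ⟨X, _, hX⟩
    obtain ⟨V, hXV, hVfd, hV⟩ := exists_finiteDimensional_subcoalgebra X
    refine ⟨V, hVfd, fun f hf => ?_⟩
    rw [← mul_smul]
    exact hX _ fun x hx => (isSubcoalgebra_iff V).1 hV x (hXV hx) f a (Or.inl hf)

/-- A nonzero rational module contains a simple submodule. -/
lemma IsRat.exists_isSimpleModule {M : Type u} [AddCommGroup M] [Module (DualAlg K C) M]
    [Nontrivial M] (hM : IsRat K C M) :
    ∃ S : Submodule (DualAlg K C) M, IsSimpleModule (DualAlg K C) S := by
  obtain ⟨m, hm⟩ := exists_ne (0 : M)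
  let _ : Module K M := Module.compHom M (algebraMap K (DualAlg K C))
  have : IsScalarTower K (DualAlg K C) M := isScalarTower_compHom
  let N := Submodule.span (DualAlg K C) {m}
  obtain ⟨X, _, hX⟩ := hM m
  have hmN : m ∈ N := Submodule.mem_span_singleton_self m
  have : Module.Finite K N := by
    refine finite_of_perp_smul_eq_zero (C := C) ⟨m, hmN⟩ (fun ⟨y, hy⟩ => ?_) X
      fun f hf => Subtype.ext (hX f hf)
    obtain ⟨f, rfl⟩ := Submodule.mem_span_singleton.1 hy
    exact ⟨f, rfl⟩
  have : Nontrivial N := ⟨⟨m, hmN⟩, 0, fun h => hm (congrArg Subtype.val h)⟩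
  exact exists_isSimpleModule_of_finite K N ‹_›

lemma IsRat.of_extOneVanishes {Q S : Type u} [AddCommGroup Q] [Module (DualAlg K C) Q]
    [AddCommGroup S] [Module (DualAlg K C) S]
    (h : ∀ ι : Type u, ExtOneVanishes K C S (ι →₀ C)) (p : Q →ₗ[DualAlg K C] S)
    (hp : Function.Surjective p) (hker : IsRat K C (LinearMap.ker p)) (hS : IsRat K C S) :
    IsRat K C Q := by
  obtain ⟨ι, φ, hφ⟩ := hker.exists_embedding
  obtain ⟨ψ, hψ⟩ := (h ι).exists_extension p hp φ
  intro q
  obtain ⟨X, _, hX⟩ := hS (p q)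
  obtain ⟨Y, _, hY⟩ := isRat_finsupp (K := K) ι (ψ q)
  refine ⟨X ⊔ Y, inferInstance, fun f hf => ?_⟩
  have h1 : f • q ∈ LinearMap.ker p := by
    rw [LinearMap.mem_ker, map_smul, hX f (perp_anti le_sup_left hf)]
  have h2 : φ ⟨f • q, h1⟩ = 0 := by
    rw [← hψ]
    change ψ (f • q) = 0
    rw [map_smul, hY f (perp_anti le_sup_right hf)]
  exact congrArg Subtype.val (hφ (h2.trans φ.map_zero.symm))

lemma ratExt_of_extOneVanishes
    (h : ∀ (S : Type u) [AddCommGroup S] [Module (DualAlg K C) S], IsRat K C S →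
      IsSimpleModule (DualAlg K C) S → ∀ ι : Type u, ExtOneVanishes K C S (ι →₀ C)) :
    RatExt K C := by
  intro M Q _ _ _ _ p hp hker hQ
  let R : Submodule (DualAlg K C) M := ratPart (K := K) (C := C) M
  suffices R = ⊤ by
    intro m
    have hm : m ∈ R := this ▸ Submodule.mem_top
    exact hm
  by_contra hR
  have : Nontrivial (M ⧸ R) := Submodule.Quotient.nontrivial_iff.2 hR
  have hle : LinearMap.ker p ≤ R := fun m hm => by
    obtain ⟨X, hX, h⟩ := hker ⟨m, hm⟩
    exact ⟨X, hX, fun f hf => congrArg Subtype.val (h f hf)⟩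
  have hMR : IsRat K C (M ⧸ R) := by
    intro x
    obtain ⟨m, rfl⟩ := Submodule.Quotient.mk_surjective _ x
    obtain ⟨X, hX, h⟩ := hQ (p m)
    exact ⟨X, hX, fun f hf => (Submodule.Quotient.mk_eq_zero R).2
      (hle ((map_smul p f m).trans (h f hf)))⟩
  obtain ⟨S, hS⟩ := hMR.exists_isSimpleModule
  have hSrat := hMR.of_injective S.subtype S.subtype_injective
  let T := S.comap R.mkQ
  let q : T →ₗ[DualAlg K C] S := R.mkQ.restrict fun _ hx => hx
  have hT : IsRat K C T := by
    refine IsRat.of_extOneVanishes (h S hSrat hS) q (fun ⟨s, hs⟩ => ?_) ?_ hSrat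
    · obtain ⟨m, rfl⟩ := Submodule.Quotient.mk_surjective _ s
      exact ⟨⟨m, hs⟩, rfl⟩
    · rintro ⟨⟨m, hm⟩, hq⟩
      have hmR : m ∈ R := (Submodule.Quotient.mk_eq_zero R).1 (congrArg Subtype.val hq)
      obtain ⟨X, hX, h⟩ := hmR
      exact ⟨X, hX, fun f hf => Subtype.ext (Subtype.ext (h f hf))⟩
  have := hS.nontrivial
  obtain ⟨⟨s, hs⟩, hs0⟩ := exists_ne (0 : S)
  obtain ⟨m, rfl⟩ := Submodule.Quotient.mk_surjective _ s
  refine hs0 (Subtype.ext ((Submodule.Quotient.mk_eq_zero R).2 ?_))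
  obtain ⟨X, hX, h⟩ := hT ⟨m, hs⟩
  exact ⟨X, hX, fun f hf => congrArg Subtype.val (h f hf)⟩

end Extensions

section Slender

/-- If infinitely many members of a family are nonzero, some functional is nonzero at infinitely
many of them. -/
lemma exists_functional_infinite {K V : Type u} [Field K] [AddCommGroup V] [Module K V]
    {ι : Type u} (d : ι → V) (hd : {i | d i ≠ 0}.Infinite) :
    ∃ f : V →ₗ[K] K, {i | f (d i) ≠ 0}.Infinite := by
  by_cases hfd : FiniteDimensional K (Submodule.span K (Set.range d))
  · let b := Module.finBasis K (Submodule.span K (Set.range d))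
    by_contra! hf
    have hg (k) : ∃ g : V →ₗ[K] K, g ∘ₗ (Submodule.span K (Set.range d)).subtype = b.coord k :=
      LinearMap.exists_extend _
    choose g hg using hg
    refine hd ((Set.finite_iUnion fun k => hf (g k)).subset fun i hi => ?_)
    have hmem : d i ∈ Submodule.span K (Set.range d) :=
      Submodule.subset_span (Set.mem_range_self i)
    rw [Set.mem_iUnion]
    by_contra! hk
    have hzero : (⟨d i, hmem⟩ : Submodule.span K (Set.range d)) = 0 := by
      refine b.ext_elem fun k => ?_
      have h1 := LinearMap.congr_fun (hg k) ⟨d i, hmem⟩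
      have h2 : g k (d i) = 0 := not_not.1 (hk k)
      rw [map_zero, Finsupp.zero_apply]
      exact h1.symm.trans h2
    exact hi (congrArg Subtype.val hzero)
  · obtain ⟨b, hb, hspan, hli⟩ := exists_linearIndependent K (Set.range d)
    have hbinf : b.Infinite := fun hfin => hfd (hspan ▸ FiniteDimensional.span_of_finite K hfin)
    let B := Module.Basis.extend hli
    refine ⟨B.constr K fun _ => (1 : K), ?_⟩
    refine Set.Infinite.of_image d (hbinf.mono fun v hv => ?_)
    obtain ⟨i, rfl⟩ := hb hv
    refine ⟨i, ?_, rfl⟩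
    have hB : B ⟨d i, Module.Basis.subset_extend hli hv⟩ = d i := Module.Basis.extend_apply_self hli _
    change B.constr K (fun _ => (1 : K)) (d i) ≠ 0
    rw [← hB, Module.Basis.constr_basis]
    exact one_ne_zero

end Slender

section ExtFinsupp

open CategoryTheory Abelian

variable {K C : Type u} [Field K] [AddCommGroup C] [Module K C] [Coalgebra K C]

lemma ExtOneVanishes.of_retract_right {S E F : Type u} [AddCommGroup S] [Module (DualAlg K C) S]
    [AddCommGroup E] [Module (DualAlg K C) E] [AddCommGroup F] [Module (DualAlg K C) F]
    (h : ExtOneVanishes K C S F) (i : E →ₗ[DualAlg K C] F) (r : F →ₗ[DualAlg K C] E)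
    (hr : r ∘ₗ i = LinearMap.id) : ExtOneVanishes K C S E := by
  refine subsingleton_of_forall_eq 0 fun e => ?_
  have h1 : e.comp (Ext.mk₀ (ModuleCat.ofHom i)) (add_zero 1) = 0 := @Subsingleton.elim _ h _ _
  have h2 : ModuleCat.ofHom i ≫ ModuleCat.ofHom r = 𝟙 (ModuleCat.of (DualAlg K C) E) :=
    ModuleCat.hom_ext hr
  rw [← Ext.comp_mk₀_id e, ← h2, ← Ext.mk₀_comp_mk₀,
    ← Ext.comp_assoc _ _ _ (add_zero 1) (add_zero 0) (by omega), h1, Ext.zero_comp]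

lemma ExtOneVanishes.finsupp {S : Type u} [AddCommGroup S] [Module (DualAlg K C) S]
    [IsSimpleModule (DualAlg K C) S] (hS : IsRat K C S) (h : ExtOneVanishes K C S C)
    (ι : Type u) : ExtOneVanishes K C S (ι →₀ C) := by
  classical
  have := IsSimpleModule.nontrivial (DualAlg K C) S
  obtain ⟨s, hs⟩ := exists_ne (0 : S)
  let p := LinearMap.toSpanSingleton (DualAlg K C) S s
  have hp : Function.Surjective p := IsSimpleModule.toSpanSingleton_surjective _ hs
  obtain ⟨X, _, hX⟩ := hS s
  obtain ⟨V, -, hV⟩ := (isClosedCofinite_of_perp_le (I := LinearMap.ker p) X hX).exists_eq_perp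
  refine extOneVanishes_of_projective p hp fun φ => ?_
  have hc (i : ι) : ∃ c : C, ∀ x : LinearMap.ker p, φ x i = x.1 • c := by
    obtain ⟨ψ, hψ⟩ := h.exists_extension p hp (Finsupp.lapply i ∘ₗ φ)
    refine ⟨ψ 1, fun x => ?_⟩
    rw [← map_smul, smul_eq_mul, mul_one]
    exact (LinearMap.congr_fun hψ x).symm
  choose c hc using hc
  let T : Set ι := {i | ∃ x : LinearMap.ker p, φ x i ≠ 0}
  have hT : T.Finite := by
    rw [← Set.not_infinite]
    intro hinf
    have hd (i : ι) : ∃ d : C, (i ∈ T → d ∉ V) ∧ ∀ x : DualAlg K C, x d ≠ 0 → x • c i ≠ 0 := by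
      by_cases hi : i ∈ T
      · obtain ⟨x, hx⟩ := hi
        rw [hc] at hx
        obtain ⟨a, ha⟩ : ∃ a : DualAlg K C, a (x.1 • c i) ≠ 0 := by
          by_contra! ha
          exact hx (eq_of_eval K fun a => (ha a).trans (map_zero a.ofConv).symm)
        refine ⟨rightAct K C a (c i), fun _ hd => ha ?_, fun y hy hyc => hy ?_⟩
        · rw [← mul_eval, ← eval_rightAct]
          have hx' : x.1 ∈ perp K V := hV ▸ x.2
          exact hx' _ hd
        · rw [eval_rightAct, mul_eval, hyc, map_zero]
      · exact ⟨0, fun h => absurd h hi, fun x hx => absurd (map_zero x.ofConv) hx⟩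
    choose d hdV hd using hd
    obtain ⟨f, hf⟩ := exists_functional_infinite (K := K) (fun i => V.mkQ (d i))
      (hinf.mono fun i hi => fun h => hdV i hi ((Submodule.Quotient.mk_eq_zero V).1 h))
    let x : DualAlg K C := WithConv.toConv (f ∘ₗ V.mkQ)
    have hx : x ∈ LinearMap.ker p := by
      have : x ∈ perp K V := fun v hv => by
        change f (V.mkQ v) = 0
        rw [Submodule.mkQ_apply, (Submodule.Quotient.mk_eq_zero V).2 hv, map_zero]
      rwa [← hV] at this
    refine hf ((φ ⟨x, hx⟩).hasFiniteSupport.subset fun i hi => ?_)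
    rw [Function.mem_support, hc]
    exact hd i x hi
  let c' : ι →₀ C := Finsupp.onFinset hT.toFinset (fun i => if i ∈ T then c i else 0)
    fun i hi => by
      rw [Set.Finite.mem_toFinset]
      by_contra h
      exact hi (if_neg h)
  refine ⟨LinearMap.toSpanSingleton (DualAlg K C) _ c',
    LinearMap.ext fun x => Finsupp.ext fun i => ?_⟩
  change x.1 • (if i ∈ T then c i else 0) = φ x i
  split_ifs with hi
  · exact (hc i x).symm
  · rw [smul_zero]
    by_contra h
    exact hi ⟨x, Ne.symm h⟩

/-- A vanishing statement for simple comodules holds for simple rational modules. -/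
lemma extOneVanishes_of_simple
    (h : ∀ (S : Type u) [AddCommGroup S] [Module K S] [RightComodule K C S],
      IsSimpleComodule K C S → ExtOneVanishes K C S C)
    (S : Type u) [AddCommGroup S] [inst : Module (DualAlg K C) S] (hS : IsRat K C S)
    (hS' : IsSimpleModule (DualAlg K C) S) : ExtOneVanishes K C S C := by
  let _ : Module K S := Module.compHom S (algebraMap K (DualAlg K C))
  have : IsScalarTower K (DualAlg K C) S := isScalarTower_compHom
  obtain ⟨I, hI⟩ := hS.exists_rightComodule
  have h1 : IsSimpleComodule K C S → @ExtOneVanishes K C _ _ _ _ S C _ (ratModule K C S) _ _ := h S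
  rw [isSimpleComodule_iff, hI] at h1
  exact h1 hS'

theorem extSimpleInjectiveVanishes_iff : ExtSimpleInjectiveVanishes K C ↔
    ∀ (S : Type u) [AddCommGroup S] [Module K S] [RightComodule K C S],
      IsSimpleComodule K C S → ExtOneVanishes K C S C := by
  constructor
  · intro h S _ _ _ hS
    exact h S C hS (isInjectiveComodule_iff.2 ratInj_self)
  · intro h S E _ _ _ _ _ _ hS hE
    rw [isInjectiveComodule_iff] at hE
    have := isSimpleComodule_iff.1 hS
    obtain ⟨ι, g, hg⟩ := (isRat_of_rightComodule (K := K) (C := C) (M := E)).exists_embedding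
    obtain ⟨r, hr⟩ := hE _ _ g LinearMap.id (isRat_finsupp ι) hg
    exact ((h S hS).finsupp isRat_of_rightComodule ι).of_retract_right g r hr

theorem isClosedUnderExtensions_iff_stable_and_vanishes :
    (rational K C).IsClosedUnderExtensions ↔
      ClosedCofiniteIdealsStable K C ∧ ExtSimpleInjectiveVanishes K C := by
  rw [isClosedUnderExtensions_iff]
  refine ⟨fun h => ⟨h.closedCofiniteIdealsStable, h.extSimpleInjectiveVanishes⟩, fun h => ?_⟩
  refine ratExt_of_extOneVanishes fun S _ _ hS hS' ι => ?_
  exact (extOneVanishes_of_simple (extSimpleInjectiveVanishes_iff.1 h.2) S hS hS').finsupp hS ι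

end ExtFinsupp

section Semisimple

variable {R X Y : Type u} [Ring R] [AddCommGroup X] [Module R X] [AddCommGroup Y] [Module R Y]

/-- If extension of homomorphisms along projective presentations is possible for the simple
submodules of a semisimple module, then so it is for the module. -/
lemma exists_presentation_of_isSemisimpleModule [IsSemisimpleModule R X]
    (h : ∀ S : Submodule R X, IsSimpleModule R S → ∀ p : R →ₗ[R] S, Function.Surjective p →
      ∀ φ : LinearMap.ker p →ₗ[R] Y, ∃ ψ : R →ₗ[R] Y, ψ ∘ₗ (LinearMap.ker p).subtype = φ) :
    ∃ (P : Type u) (_ : AddCommGroup P) (_ : Module R P) (p : P →ₗ[R] X),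
      Module.Projective R P ∧ Function.Surjective p ∧ ∀ φ : LinearMap.ker p →ₗ[R] Y,
        ∃ ψ : P →ₗ[R] Y, ψ ∘ₗ (LinearMap.ker p).subtype = φ := by
  classical
  obtain ⟨s, e, -, hs⟩ := IsSemisimpleModule.exists_linearEquiv_dfinsupp R X
  have hp (m : s) : ∃ p : R →ₗ[R] m.1, Function.Surjective p := by
    have := (hs m).nontrivial
    obtain ⟨x, hx⟩ := exists_ne (0 : m.1)
    exact ⟨_, IsSimpleModule.toSpanSingleton_surjective R hx⟩
  choose p hp using hp
  let q : (Π₀ _ : s, R) →ₗ[R] Π₀ m : s, m.1 := DFinsupp.mapRange.linearMap p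
  have hq : Function.Surjective q :=
    (DFinsupp.mapRange_surjective _ fun m => (p m).map_zero).2 hp
  refine ⟨Π₀ _ : s, R, inferInstance, inferInstance, e.symm.toLinearMap ∘ₗ q, inferInstance,
    e.symm.surjective.comp hq, fun φ => ?_⟩
  have hker (ξ : Π₀ _ : s, R) (hξ : e.symm (q ξ) = 0) (m : s) : p m (ξ m) = 0 := by
    rw [LinearEquiv.map_eq_zero_iff] at hξ
    exact DFunLike.congr_fun hξ m
  have hsingle (m : s) (x : R) (hx : p m x = 0) :
      DFinsupp.single m x ∈ LinearMap.ker (e.symm.toLinearMap ∘ₗ q) := by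
    have h1 : q (DFinsupp.single m x) = DFinsupp.single m (p m x) :=
      DFinsupp.mapRange_single (hf := fun m => (p m).map_zero)
    rw [LinearMap.mem_ker, LinearMap.comp_apply, h1, hx, DFinsupp.single_zero, map_zero]
  have hψ (m : s) : ∃ ψ : R →ₗ[R] Y, ∀ x (hx : p m x = 0), ψ x = φ ⟨_, hsingle m x hx⟩ := by
    obtain ⟨ψ, hψ⟩ := h m.1 (hs m) (p m) (hp m) (φ ∘ₗ ((DFinsupp.lsingle m ∘ₗ
      (LinearMap.ker (p m)).subtype).codRestrict _ fun x => hsingle m x.1 x.2))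
    exact ⟨ψ, fun x hx => LinearMap.congr_fun hψ ⟨x, hx⟩⟩
  choose ψ hψ using hψ
  refine ⟨DFinsupp.lsum ℕ ψ, LinearMap.ext fun ⟨ξ, hξ⟩ => ?_⟩
  have hsum : (⟨ξ, hξ⟩ : LinearMap.ker (e.symm.toLinearMap ∘ₗ q)) =
      ∑ m ∈ ξ.support, ⟨DFinsupp.single m (ξ m), hsingle m _ (hker ξ hξ m)⟩ := by
    refine Subtype.ext ?_
    rw [AddSubmonoidClass.coe_finsetSum]
    exact (DFinsupp.sum_single (f := ξ)).symm
  rw [hsum, map_sum, map_sum]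
  refine Finset.sum_congr rfl fun m _ => ?_
  rw [LinearMap.comp_apply, Submodule.subtype_apply, DFinsupp.lsum_single,
    hψ m _ (hker ξ hξ m)]

lemma exists_hom_ne_zero_of_finsupp {ι : Type u} [Nontrivial X] (g : X →ₗ[R] ι →₀ Y)
    (hg : Function.Injective g) : ∃ f : X →ₗ[R] Y, f ≠ 0 := by
  by_contra! h
  obtain ⟨x, hx⟩ := exists_ne (0 : X)
  refine hx (hg (Finsupp.ext fun i => ?_))
  rw [map_zero, Finsupp.zero_apply]
  exact LinearMap.congr_fun (h (Finsupp.lapply i ∘ₗ g)) x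

lemma isSemisimpleModule_sSup_simples :
    IsSemisimpleModule R ↥(sSup {S : Submodule R X | IsSimpleModule R S}) := by
  rw [sSup_eq_iSup]
  exact isSemisimpleModule_biSup_of_isSemisimpleModule_submodule fun S hS => by
    have : IsSimpleModule R S := hS
    infer_instance

lemma isotypicComponent_eq_of_le {S N : Submodule R X} [IsSimpleModule R S]
    [IsSimpleModule R N] (h : N ≤ isotypicComponent R X S) :
    isotypicComponent R X S = isotypicComponent R X N :=
  eq_isotypicComponent_of_le ⟨S, inferInstance, rfl⟩ h

lemma exists_isSimpleModule_le {N : Submodule R X}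
    (h : ∃ S : Submodule R N, IsSimpleModule R S) : ∃ S ≤ N, IsSimpleModule R S := by
  obtain ⟨S, hS⟩ := h
  exact ⟨S.map N.subtype, Submodule.map_subtype_le _ _,
    IsSimpleModule.congr (S.equivMapOfInjective N.subtype N.subtype_injective).symm⟩

lemma isSimpleModule_range [IsSimpleModule R X] (f : X →ₗ[R] Y) (hf : Function.Injective f) :
    IsSimpleModule R (LinearMap.range f) :=
  IsSimpleModule.congr (LinearEquiv.ofInjective f hf).symm

lemma exists_retraction_of_isSemisimpleModule [IsSemisimpleModule R Y] (f : X →ₗ[R] Y)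
    (hf : Function.Injective f) : ∃ r : Y →ₗ[R] X, r ∘ₗ f = LinearMap.id :=
  IsSemisimpleModule.extension_property f hf LinearMap.id

end Semisimple

section Coradical

variable {K C : Type u} [Field K] [AddCommGroup C] [Module K C] [Coalgebra K C]

/-- The right action of an element of the dual algebra as an endomorphism of the left module. -/
noncomputable def rightActHom (f : DualAlg K C) : C →ₗ[DualAlg K C] C where
  toFun := rightAct K C f
  map_add' := map_add _
  map_smul' a c := eq_of_eval K fun g => by
    rw [RingHom.id_apply, eval_rightAct, ← mul_eval g a, eval_rightAct, ← mul_eval, mul_assoc]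

lemma isSubcoalgebra_of_isFullyInvariant {T : Submodule (DualAlg K C) C}
    (hT : T.IsFullyInvariant) : IsSubcoalgebra K (T.restrictScalars K) := by
  refine (isSubcoalgebra_iff _).2 fun v hv f g hfg => ?_
  rcases hfg with h | h
  · rw [mul_eval]
    exact h _ (T.smul_mem g hv)
  · rw [← eval_rightAct]
    exact h _ (hT (rightActHom f) hv)

lemma IsSubcoalgebra.smul_mem {V : Submodule K C} (hV : IsSubcoalgebra K V) (f : DualAlg K C)
    {v : C} (hv : v ∈ V) : f • v ∈ V := by
  refine mem_of_forall_perp fun g hg => ?_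
  rw [← mul_eval]
  exact (isSubcoalgebra_iff V).1 hV v hv g f (Or.inl hg)

lemma IsSubcoalgebra.map_mem {V : Submodule K C} (hV : IsSubcoalgebra K V)
    (g : C →ₗ[DualAlg K C] C) {v : C} (hv : v ∈ V) : g v ∈ V := by
  refine mem_of_forall_perp fun f hf => ?_
  have h1 : f • v = 0 := eq_of_eval K fun a => by
    rw [← mul_eval, (isSubcoalgebra_iff V).1 hV v hv a f (Or.inr hf)]
    exact (map_zero a.ofConv).symm
  rw [← one_mul f, mul_eval, ← map_smul, h1, map_zero]
  exact map_zero (1 : DualAlg K C).ofConv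

/-- A subcoalgebra as a left submodule over the dual algebra. -/
def IsSubcoalgebra.toSubmodule {V : Submodule K C} (hV : IsSubcoalgebra K V) :
    Submodule (DualAlg K C) C := { V with smul_mem' := fun f _ hv => hV.smul_mem f hv }

lemma IsSubcoalgebra.exists_isSimpleModule_le {V : Submodule K C} (hV : IsSubcoalgebra K V)
    (h : V ≠ ⊥) : ∃ S ≤ hV.toSubmodule, IsSimpleModule (DualAlg K C) S := by
  obtain ⟨v, hv, hv0⟩ := V.ne_bot_iff.1 h
  have : Nontrivial hV.toSubmodule := ⟨⟨v, hv⟩, 0, fun h => hv0 (congrArg Subtype.val h)⟩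
  have hrat : IsRat K C hV.toSubmodule := isRat_of_rightComodule.of_injective
    hV.toSubmodule.subtype hV.toSubmodule.subtype_injective
  exact CoalgExt.exists_isSimpleModule_le hrat.exists_isSimpleModule

lemma IsSubcoalgebra.isotypicComponent_le {V : Submodule K C} (hV : IsSubcoalgebra K V)
    {S : Submodule (DualAlg K C) C} (hS : S ≤ hV.toSubmodule) :
    isotypicComponent (DualAlg K C) C S ≤ hV.toSubmodule := by
  refine sSup_le fun m ⟨e⟩ x hx => ?_
  obtain ⟨g, hg⟩ := ratInj_self S C S.subtype (m.subtype ∘ₗ e.symm.toLinearMap)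
    isRat_of_rightComodule S.subtype_injective
  have h1 : g (e ⟨x, hx⟩) = x := by
    have := LinearMap.congr_fun hg (e ⟨x, hx⟩)
    simpa using this
  rw [← h1]
  exact hV.map_mem g (hS (e ⟨x, hx⟩).2)

lemma isSimpleSubcoalgebra_isotypicComponent (S : Submodule (DualAlg K C) C)
    [IsSimpleModule (DualAlg K C) S] :
    IsSimpleSubcoalgebra K ((isotypicComponent (DualAlg K C) C S).restrictScalars K) := by
  refine ⟨isSubcoalgebra_of_isFullyInvariant (.isotypicComponent _ _ _), ?_, fun W hW hWsub => ?_⟩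
  · rw [Ne, Submodule.restrictScalars_eq_bot_iff]
    exact (bot_lt_isotypicComponent S).ne'
  · by_cases hW0 : W = ⊥
    · exact Or.inl hW0
    · obtain ⟨N, hNW, hN⟩ := hWsub.exists_isSimpleModule_le hW0
      have hNT : N ≤ isotypicComponent (DualAlg K C) C S := fun x hx => hW (hNW hx)
      refine Or.inr (le_antisymm hW ?_)
      rw [isotypicComponent_eq_of_le hNT]
      exact hWsub.isotypicComponent_le hNW

lemma IsSimpleSubcoalgebra.exists_eq_isotypicComponent {V : Submodule K C}
    (hV : IsSimpleSubcoalgebra K V) : ∃ S : Submodule (DualAlg K C) C,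
      IsSimpleModule (DualAlg K C) S ∧
        V = (isotypicComponent (DualAlg K C) C S).restrictScalars K := by
  obtain ⟨S, hSV, hS⟩ := hV.1.exists_isSimpleModule_le hV.2.1
  refine ⟨S, hS, ?_⟩
  have h := isSimpleSubcoalgebra_isotypicComponent S
  exact ((hV.2.2 _ (hV.1.isotypicComponent_le hSV) h.1).resolve_left h.2.1).symm

lemma coradicalSubmodule_eq_sSup : coradicalSubmodule K C =
    sSup {S : Submodule (DualAlg K C) C | IsSimpleModule (DualAlg K C) S} := by
  refine le_antisymm ?_ (sSup_le fun S hS => ?_)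
  · have : coradical K C ≤ (sSup {S : Submodule (DualAlg K C) C |
        IsSimpleModule (DualAlg K C) S}).restrictScalars K := by
      refine sSup_le fun V hV => ?_
      obtain ⟨S, hS, rfl⟩ := hV.exists_eq_isotypicComponent
      have h1 : isotypicComponent (DualAlg K C) C S ≤
          sSup {S : Submodule (DualAlg K C) C | IsSimpleModule (DualAlg K C) S} :=
        sSup_le_sSup fun m ⟨e⟩ => IsSimpleModule.congr e
      exact h1
    exact this
  · have : IsSimpleModule (DualAlg K C) S := hS
    have h1 : (isotypicComponent (DualAlg K C) C S).restrictScalars K ≤ coradical K C :=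
      le_sSup (isSimpleSubcoalgebra_isotypicComponent S)
    exact fun x hx => h1 (S.le_isotypicComponent hx)

instance : IsSemisimpleModule (DualAlg K C) (coradicalSubmodule K C) := by
  rw [coradicalSubmodule_eq_sSup]
  exact isSemisimpleModule_sSup_simples

theorem extSimpleInjectiveVanishes_iff_coradical : ExtSimpleInjectiveVanishes K C ↔
    ExtOneVanishes K C (coradicalSubmodule K C) C := by
  rw [extSimpleInjectiveVanishes_iff]
  have hrat : IsRat K C (coradicalSubmodule K C) := isRat_of_rightComodule.of_injective
    (coradicalSubmodule K C).subtype (coradicalSubmodule K C).subtype_injective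
  constructor
  · intro h
    obtain ⟨P, _, _, p, _, hp, hext⟩ := exists_presentation_of_isSemisimpleModule
      (R := DualAlg K C) (X := coradicalSubmodule K C) (Y := C) fun S hS p hp φ =>
        (extOneVanishes_of_simple h S (hrat.of_injective S.subtype S.subtype_injective)
          hS).exists_extension p hp φ
    exact extOneVanishes_of_projective p hp hext
  · intro h S _ _ _ hS
    have hS' := isSimpleComodule_iff.1 hS
    have := hS'.nontrivial
    obtain ⟨ι, g, hg⟩ := (isRat_of_rightComodule (K := K) (C := C) (M := S)).exists_embedding
    obtain ⟨f, hf0⟩ := exists_hom_ne_zero_of_finsupp g hg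
    have hf := f.injective_or_eq_zero.resolve_right hf0
    have hmem (x : S) : f x ∈ coradicalSubmodule K C := by
      rw [coradicalSubmodule_eq_sSup]
      have h1 : LinearMap.range f ≤
          sSup {S : Submodule (DualAlg K C) C | IsSimpleModule (DualAlg K C) S} :=
        le_sSup (isSimpleModule_range f hf)
      exact h1 ⟨x, rfl⟩
    let j : S →ₗ[DualAlg K C] coradicalSubmodule K C := f.codRestrict _ hmem
    have hj : Function.Injective j := fun x y hxy => hf (congrArg Subtype.val hxy)
    obtain ⟨r, hr⟩ := exists_retraction_of_isSemisimpleModule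
      (R := DualAlg K C) (X := S) (Y := coradicalSubmodule K C) j hj
    exact h.of_retract j r hr

end Coradical

end CoalgExt

theorem theorem3 (K C : Type u) [Field K] [AddCommGroup C] [Module K C] [Coalgebra K C] :
    ((CoalgExt.rational K C).IsClosedUnderExtensions ↔
      CoalgExt.ClosedCofiniteIdealsStable K C ∧ CoalgExt.ExtSimpleInjectiveVanishes K C) ∧
    (CoalgExt.ClosedCofiniteIdealsStable K C ↔
      CoalgExt.LocallyFinite K C ∧
        ∀ V W : Submodule K C, CoalgExt.IsSubcoalgebra K V → CoalgExt.IsSubcoalgebra K W →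
          FiniteDimensional K V → FiniteDimensional K W →
          CoalgExt.perp K V * CoalgExt.perp K W = CoalgExt.perp K (CoalgExt.wedge K V W)) ∧
    (CoalgExt.ExtSimpleInjectiveVanishes K C ↔
      ∀ (S : Type u) [AddCommGroup S] [Module K S] [CoalgExt.RightComodule K C S],
        CoalgExt.IsSimpleComodule K C S → CoalgExt.ExtOneVanishes K C S C) ∧
    (CoalgExt.ExtSimpleInjectiveVanishes K C ↔
      CoalgExt.ExtOneVanishes K C (CoalgExt.coradicalSubmodule K C) C) :=
  ⟨CoalgExt.isClosedUnderExtensions_iff_stable_and_vanishes,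
    CoalgExt.closedCofiniteIdealsStable_iff, CoalgExt.extSimpleInjectiveVanishes_iff,
    CoalgExt.extSimpleInjectiveVanishes_iff_coradical⟩
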